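/- Let $V$ be a Euclidean vector space of dimension $n$ with inner product $(\cdot,\cdot)$. For a convex polyhedral cone $K$ in a Euclidean space write $\langle K\rangle$ for its linear span, $\dim K=\dim\langle K\rangle$, and let $\sigma(K)=\operatorname{vol}(K\cap B)/\operatorname{vol}(B)$ be its relative angle measure, where $B$ is the unit ball of $\langle K\rangle$ centered at the origin and the volume is that of $\langle K\rangle$ (so $\sigma(\{0\})=1$). Let $W\subset O(V)$ be a finite reflection group, i.e. a finite group generated by orthogonal reflections in hyperplanes, and let $C$ be a fundamental cone of $W$, i.e. the closure of a connected component of the complement in $V$ of the union of all reflection hyperplanes of $W$. For a face $F$ of $C$ let $C/F$ be the orthogonal projection of $C$ to $\langle F\rangle^{\perp}$, and let $(C/F)^*=\{v\in\langle F\rangle^{\perp} : (v,u)\ge 0 \text{ for all } u\in C/F\}$ be its dual cone in $\langle F\rangle^{\perp}$. For $0\le k\le n$ put $W^k=\{w\in W:\dim\ker(1-w)=k\}$. Theorem. For each $k=0,\ldots,n$, the cone $C$ has finitely many $k$-dimensional faces, and $$\sum_{F\subset C,\ \dim F=k}\sigma(F)\cdot\sigma\bigl((C/F)^*\bigr)=\frac{|W^{k}|}{|W|},$$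 where $F$ runs over the $k$-dimensional faces of $C$ (including $C$ itself when $k=n$). -/

import Mathlib

open Module MeasureTheory

namespace ReflectionCone

noncomputable section

section AngleMeasure

variable {E : Type*} [NormedAddCommGroup E] [InnerProductSpace ℝ E] [FiniteDimensional ℝ E]

/-- The linear span `⟨C⟩` of a convex cone `C`. -/
def linSpan (C : PointedCone ℝ E) : Submodule ℝ E := Submodule.span ℝ (C : Set E)

/-- The dimension of a convex cone, i.e. the dimension of its linear span. -/
def dim (C : PointedCone ℝ E) : ℕ := finrank ℝ (linSpan C)

/-- Lebesgue measure of a Euclidean space (on its Borel sets), normalized by the cube spanned by an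
orthonormal basis. This is Mathlib's `volume` of a finite-dimensional inner product space, spelled
out so that it is never confused with the restriction of the volume of an ambient space. -/
def vol (E : Type*) [NormedAddCommGroup E] [InnerProductSpace ℝ E] [FiniteDimensional ℝ E] :
    @Measure E (borel E) :=
  letI : MeasurableSpace E := borel E
  haveI : BorelSpace E := ⟨rfl⟩
  (stdOrthonormalBasis ℝ E).toBasis.addHaar

/-- The relative angle measure `σ(C) = vol (C ∩ B) / vol B`, where `B` is the unit ball of the
linear span of `C` and the volume is that of the linear span. -/
def angleMeasure (C : PointedCone ℝ E) : ℝ :=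
  (vol (linSpan C)
      ({x : linSpan C | (x : E) ∈ C} ∩ Metric.closedBall (0 : linSpan C) 1)).toReal /
    (vol (linSpan C) (Metric.closedBall (0 : linSpan C) 1)).toReal

/-- The dual cone `C* = {v | (v, u) ≥ 0 for all u ∈ C}` in the Euclidean space `E`. -/
def dualCone (C : PointedCone ℝ E) : PointedCone ℝ E :=
  (ProperCone.innerDual (C : Set E)).toPointedCone

/-- The cone `C/F`: the orthogonal projection of `C` to the orthogonal complement of the linear span
of `F`, regarded as a cone in the Euclidean space `⟨F⟩ᗮ`. -/
def coneQuot (C F : PointedCone ℝ E) : PointedCone ℝ (linSpan F)ᗮ :=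
  C.map ((linSpan F)ᗮ.orthogonalProjectionOnto : E →ₗ[ℝ] (linSpan F)ᗮ)

/-- The set of all `k`-dimensional faces of the cone `C`. -/
def faces (C : PointedCone ℝ E) (k : ℕ) : Set (PointedCone ℝ E) :=
  {F | F.IsFaceOf C ∧ dim F = k}

end AngleMeasure

section ReflectionGroup

variable {V : Type*} [NormedAddCommGroup V] [InnerProductSpace ℝ V] [FiniteDimensional ℝ V]

/-- A finite reflection group: a finite group of linear isometries of a Euclidean space that is
generated by orthogonal reflections in hyperplanes. -/
structure IsFiniteReflectionGroup (W : Subgroup (V ≃ₗᵢ[ℝ] V)) : Prop where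
  finite : Finite W
  closure_reflections :
    Subgroup.closure {s : V ≃ₗᵢ[ℝ] V | s ∈ W ∧ ∃ v : V, v ≠ 0 ∧ s = (ℝ ∙ v)ᗮ.reflection} = W

/-- The complement of the union of all reflection hyperplanes of `W`. -/
def regularPoints (W : Subgroup (V ≃ₗᵢ[ℝ] V)) : Set V :=
  {x | ∀ v : V, v ≠ 0 → (ℝ ∙ v)ᗮ.reflection ∈ W → x ∉ (ℝ ∙ v)ᗮ}

/-- A fundamental cone (closed Weyl chamber) of `W`: the closure of a connected component of the
complement of the union of the reflection hyperplanes. -/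
def IsFundamentalCone (W : Subgroup (V ≃ₗᵢ[ℝ] V)) (C : PointedCone ℝ V) : Prop :=
  ∃ x ∈ regularPoints W, (C : Set V) = closure (connectedComponentIn (regularPoints W) x)

/-- The set `W^k` of all elements of `W` whose fixed space `ker (1 - w)` has dimension `k`. -/
def fixedDim (W : Subgroup (V ≃ₗᵢ[ℝ] V)) (k : ℕ) : Set (V ≃ₗᵢ[ℝ] V) :=
  {w | w ∈ W ∧
    finrank ℝ (LinearMap.ker (LinearMap.id - (w.toLinearEquiv : V →ₗ[ℝ] V))) = k}

end ReflectionGroup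

end

end ReflectionCone

/-!
The standard Gaussian measure turns angles into probabilities and makes the projections to
orthogonal subspaces independent. By the Moreau decomposition, almost every vector has its nearest
point in `C` in the relative interior of exactly one face `F`, so the Gaussian measure `γ(F)` of `F`
in `⟨F⟩` times the Gaussian measure of the dual of `C/F`, summed over all faces `F`, gives `1`.

On the other hand, a generic vector of the fixed space of `w` lies in as many of the cones `g⁻¹C` as
its stabilizer has elements. Averaging over `g`, any sum over `w ∈ W` of a `W`-invariant function of
the fixed space of `w` becomes `|W|` times a sum over the faces, in which `F` is weighted by `γ(F)`
and by the proportion of elements of the stabilizer `W_F` whose fixed space is exactly `⟨F⟩`. For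
the constant function `1` these weights also sum to `1`. The stabilizer `W_F` acts on `C + ⟨F⟩` just
as `W` acts on `C`, so comparing the two sums by induction on `|W|` identifies the angle of the dual
of `C/F` with that proportion. The function counting fixed spaces of dimension `k` then gives the
theorem.
-/

namespace ReflectionCone

open Filter ProbabilityTheory
open scoped InnerProductSpace Pointwise ENNReal Topology Real

section Cone

variable {E : Type*} [NormedAddCommGroup E] [InnerProductSpace ℝ E] {C F : PointedCone ℝ E} {x : E}

lemma mem_linSpan (hx : x ∈ C) : x ∈ linSpan C := Submodule.subset_span hx

lemma exists_add_mem_of_mem_linSpan (hx : x ∈ linSpan C) : ∃ a ∈ C, x + a ∈ C := by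
  induction hx using Submodule.span_induction with
  | mem x hx => exact ⟨0, C.zero_mem, by simpa using hx⟩
  | zero => exact ⟨0, C.zero_mem, by simp⟩
  | add x y _ _ hx hy =>
    obtain ⟨a, ha, hxa⟩ := hx
    obtain ⟨b, hb, hyb⟩ := hy
    exact ⟨a + b, C.add_mem ha hb, add_add_add_comm x y a b ▸ C.add_mem hxa hyb⟩
  | smul r x _ hx =>
    obtain ⟨a, ha, hxa⟩ := hx
    rcases le_total 0 r with hr | hr
    · exact ⟨r • a, C.smul_mem hr ha, smul_add r x a ▸ C.smul_mem hr hxa⟩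
    · refine ⟨-r • (x + a), C.smul_mem (neg_nonneg.2 hr) hxa, ?_⟩
      have h : r • x + -r • (x + a) = -r • a := by module
      exact h ▸ C.smul_mem (neg_nonneg.2 hr) ha

lemma mem_of_mem_linSpan_of_isFaceOf (hF : F.IsFaceOf C) (hx : x ∈ C) (hxF : x ∈ linSpan F) :
    x ∈ F := by
  obtain ⟨a, ha, hxa⟩ := exists_add_mem_of_mem_linSpan hxF
  exact hF.mem_of_add_mem_left hx (hF.le ha) hxa

end Cone

section FixedSpaces

variable {V : Type*} [NormedAddCommGroup V] [InnerProductSpace ℝ V] {W : Subgroup (V ≃ₗᵢ[ℝ] V)}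
  {X : Submodule ℝ V} {w : V ≃ₗᵢ[ℝ] V} {x : V}

/-- The space `ker (1 - w)` of vectors fixed by `w`. -/
def fixedSpace (w : V ≃ₗᵢ[ℝ] V) : Submodule ℝ V :=
  LinearMap.ker (LinearMap.id - (w.toLinearEquiv : V →ₗ[ℝ] V))

lemma mem_fixedSpace : x ∈ fixedSpace w ↔ w x = x :=
  sub_eq_zero.trans eq_comm

/-- The pointwise stabilizer of the subspace `X` in `W`. -/
def fixer (W : Subgroup (V ≃ₗᵢ[ℝ] V)) (X : Submodule ℝ V) : Subgroup (V ≃ₗᵢ[ℝ] V) where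
  carrier := {w | w ∈ W ∧ ∀ x ∈ X, w x = x}
  one_mem' := ⟨W.one_mem, fun _ _ => rfl⟩
  mul_mem' ha hb := ⟨W.mul_mem ha.1 hb.1, fun x hx =>
    (congrArg _ (hb.2 x hx)).trans (ha.2 x hx)⟩
  inv_mem' {w} hw := ⟨W.inv_mem hw.1, fun x hx => w.symm_apply_eq.2 (hw.2 x hx).symm⟩

lemma mem_fixer : w ∈ fixer W X ↔ w ∈ W ∧ ∀ x ∈ X, w x = x := Iff.rfl

lemma mem_fixer_iff_le_fixedSpace : w ∈ fixer W X ↔ w ∈ W ∧ X ≤ fixedSpace w := by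
  simp only [mem_fixer, SetLike.le_def, mem_fixedSpace]

lemma fixer_le : fixer W X ≤ W := fun _ hw => hw.1

instance [Finite W] : Finite (fixer W X) :=
  Finite.of_injective _ (Subgroup.inclusion_injective fixer_le)

/-- The space of vectors fixed by every element of `W`. -/
def commonFixed (W : Subgroup (V ≃ₗᵢ[ℝ] V)) : Submodule ℝ V := ⨅ w ∈ W, fixedSpace w

lemma mem_commonFixed : x ∈ commonFixed W ↔ ∀ w ∈ W, w x = x := by
  simp only [commonFixed, Submodule.mem_iInf, mem_fixedSpace]

lemma le_commonFixed_fixer : X ≤ commonFixed (fixer W X) :=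
  fun x hx => mem_commonFixed.2 fun _ hw => hw.2 x hx

lemma inner_inv_apply (g : V ≃ₗᵢ[ℝ] V) (x y : V) : ⟪g⁻¹ x, y⟫_ℝ = ⟪x, g y⟫_ℝ :=
  g.symm.inner_map_eq_flip x y

end FixedSpaces

/-- The cone `C` behaves like a Dirichlet domain of `W`: its translates cover the space, and each of
its points maximizes the inner product with every vector of `C` over its `W`-orbit. Fundamental
cones of reflection groups have this property, and unlike the property of being generated by
reflections it passes directly to the stabilizers of faces. -/
structure IsDirichlet {V : Type*} [NormedAddCommGroup V] [InnerProductSpace ℝ V]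
    (W : Subgroup (V ≃ₗᵢ[ℝ] V)) (C : PointedCone ℝ V) : Prop where
  exists_apply_mem : ∀ x, ∃ g ∈ W, g x ∈ C
  inner_apply_le : ∀ w ∈ W, ∀ x ∈ C, ∀ c ∈ C, ⟪w x, c⟫_ℝ ≤ ⟪x, c⟫_ℝ

namespace IsDirichlet

variable {V : Type*} [NormedAddCommGroup V] [InnerProductSpace ℝ V] {W : Subgroup (V ≃ₗᵢ[ℝ] V)}
  {C F : PointedCone ℝ V} {w : V ≃ₗᵢ[ℝ] V} {x y : V}

lemma apply_eq_of_apply_mem (h : IsDirichlet W C) (hw : w ∈ W) (hx : x ∈ C) (hwx : w x ∈ C) :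
    w x = x := by
  have hle : ‖x‖ ^ 2 ≤ ⟪w x, x⟫_ℝ := by
    simpa [real_inner_comm] using h.inner_apply_le w hw x hx (w x) hwx
  have hsub : ‖w x - x‖ ^ 2 ≤ 0 := by
    rw [norm_sub_sq_real, w.norm_map]
    linarith
  exact sub_eq_zero.1 (norm_eq_zero.1 (sq_nonpos_iff _ |>.1 hsub))

lemma commonFixed_le (h : IsDirichlet W C) : (commonFixed W : PointedCone ℝ V) ≤ C := by
  intro x hx
  obtain ⟨g, hg, hgx⟩ := h.exists_apply_mem x
  rwa [mem_commonFixed.1 hx g hg] at hgx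

section Finite

variable [Finite W]

lemma linSpan_eq_top (h : IsDirichlet W C) : linSpan C = ⊤ := by
  let p (g : W) : Submodule ℝ V := (linSpan C).comap (g.1.toLinearEquiv : V →ₗ[ℝ] V)
  have hcover : ⋃ g, (p g : Set V) = Set.univ := by
    refine Set.eq_univ_of_forall fun x => ?_
    obtain ⟨g, hg, hgx⟩ := h.exists_apply_mem x
    exact Set.mem_iUnion.2 ⟨⟨g, hg⟩, mem_linSpan hgx⟩
  obtain ⟨g, hg⟩ := Subspace.exists_eq_top_of_iUnion_eq_univ hcover
  have hrange := LinearMap.range_le_iff_comap.2 hg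
  rwa [LinearEquiv.range, top_le_iff] at hrange

lemma eq_of_forall_inner_eq (h : IsDirichlet W C) (hxy : ∀ c ∈ C, ⟪x, c⟫_ℝ = ⟪y, c⟫_ℝ) :
    x = y :=
  ext_inner_right ℝ (LinearMap.congr_fun
    (LinearMap.ext_on h.linSpan_eq_top hxy : innerₛₗ ℝ x = innerₛₗ ℝ y))

lemma apply_eq_of_apply_add_eq (h : IsDirichlet W C) (hw : w ∈ W) (hx : x ∈ C) (hy : y ∈ C)
    (hxy : w (x + y) = x + y) : w x = x := by
  refine h.eq_of_forall_inner_eq fun c hc => ?_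
  have hinner := congrArg (⟪·, c⟫_ℝ) hxy
  simp only [map_add, inner_add_left] at hinner
  linarith [h.inner_apply_le w hw x hx c hc, h.inner_apply_le w hw y hy c hc]

lemma isFaceOf_inf_fixedSpace (h : IsDirichlet W C) (hw : w ∈ W) :
    (C ⊓ (fixedSpace w : PointedCone ℝ V)).IsFaceOf C :=
  .of_mem_of_add_mem_left inf_le_left fun hx hy hxy =>
    ⟨hx, mem_fixedSpace.2 (h.apply_eq_of_apply_add_eq hw hx hy (mem_fixedSpace.1 hxy.2))⟩

lemma isFaceOf_inf_commonFixed (h : IsDirichlet W C) {G : Subgroup (V ≃ₗᵢ[ℝ] V)} (hG : G ≤ W) :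
    (C ⊓ (commonFixed G : PointedCone ℝ V)).IsFaceOf C :=
  .of_mem_of_add_mem_left inf_le_left fun hx hy hxy =>
    ⟨hx, mem_commonFixed.2 fun w hw =>
      h.apply_eq_of_apply_add_eq (hG hw) hx hy (mem_commonFixed.1 hxy.2 w hw)⟩

lemma mem_iff (h : IsDirichlet W C) : x ∈ C ↔ ∀ w ∈ W, ∀ c ∈ C, ⟪w x, c⟫_ℝ ≤ ⟪x, c⟫_ℝ := by
  refine ⟨fun hx w hw => h.inner_apply_le w hw x hx, fun hx => ?_⟩
  obtain ⟨g, hg, hgx⟩ := h.exists_apply_mem x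
  have hle : ∀ c ∈ C, ⟪x, c⟫_ℝ ≤ ⟪g x, c⟫_ℝ := by
    have := h.inner_apply_le g⁻¹ (W.inv_mem hg) (g x) hgx
    rwa [show g⁻¹ (g x) = x from g.symm_apply_apply x] at this
  rwa [h.eq_of_forall_inner_eq fun c hc => (hx g hg c hc).antisymm (hle c hc)] at hgx

lemma isClosed (h : IsDirichlet W C) : IsClosed (C : Set V) := by
  have hC : (C : Set V) = ⋂ w ∈ W, ⋂ c ∈ C, {x | ⟪w x, c⟫_ℝ ≤ ⟪x, c⟫_ℝ} := by
    ext x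
    simp only [SetLike.mem_coe, h.mem_iff (x := x), Set.mem_iInter, Set.mem_ofPred_eq]
  rw [hC]
  exact isClosed_biInter fun w _ => isClosed_biInter fun c _ =>
    isClosed_le (by fun_prop) (by fun_prop)

lemma exists_apply_add_smul_mem (h : IsDirichlet W C) (hx : x ∈ C) (y : V) :
    ∃ w ∈ W, w x = x ∧ ∃ t : ℝ, 0 < t ∧ w (x + t • y) ∈ C := by
  obtain ⟨⟨w, hw⟩, hfreq⟩ : ∃ w : W, ∃ᶠ t : ℝ in 𝓝[>] 0, w.1 (x + t • y) ∈ C := by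
    by_contra! hnever
    obtain ⟨t, ht⟩ := (eventually_all.2 hnever).exists
    obtain ⟨g, hg, hgt⟩ := h.exists_apply_mem (x + t • y)
    exact ht ⟨g, hg⟩ hgt
  have hlim : Tendsto (fun t : ℝ => w (x + t • y)) (𝓝[>] 0) (𝓝 (w x)) := by
    have hcont : Continuous fun t : ℝ => w (x + t • y) := by fun_prop
    simpa using (hcont.tendsto 0).mono_left nhdsWithin_le_nhds
  obtain ⟨t, htC, ht⟩ := (hfreq.and_eventually self_mem_nhdsWithin).exists
  exact ⟨w, hw, h.apply_eq_of_apply_mem hw hx (h.isClosed.mem_of_frequently_of_tendsto hfreq hlim),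
    t, ht, htC⟩

variable [FiniteDimensional ℝ V]

lemma exists_mem_forall_mem_fixer (h : IsDirichlet W C) (hF : F ≤ C) :
    ∃ f ∈ F, ∀ w ∈ W, w f = f → w ∈ fixer W (linSpan F) := by
  obtain ⟨s, hsF, hs⟩ := (Submodule.fg_span_iff_fg_span_finset_subset (F : Set V)).1
    (IsNoetherian.noetherian (R := ℝ) _)
  refine ⟨∑ x : s, x.1, sum_mem fun x _ => hsF x.2, fun w hw hwf => ?_⟩
  have hfix := ((h.isFaceOf_inf_fixedSpace hw).sum_mem_iff_mem fun x : s => hF (hsF x.2)).1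
    ⟨sum_mem fun x _ => hF (hsF x.2), mem_fixedSpace.2 hwf⟩
  refine mem_fixer_iff_le_fixedSpace.2 ⟨hw, ?_⟩
  rw [linSpan, hs, Submodule.span_le]
  exact fun x hx => (hfix ⟨x, hx⟩).2

lemma localize (h : IsDirichlet W C) (hF : F ≤ C) :
    IsDirichlet (fixer W (linSpan F)) (C ⊔ (linSpan F : PointedCone ℝ V)) where
  exists_apply_mem y := by
    obtain ⟨f, hfF, hf⟩ := h.exists_mem_forall_mem_fixer hF
    obtain ⟨w, hw, hwf, t, ht, hwt⟩ := h.exists_apply_add_smul_mem (hF hfF) y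
    refine ⟨w, hf w hw hwf, Submodule.mem_sup.2 ⟨t⁻¹ • w (f + t • y), ?_, -t⁻¹ • f, ?_, ?_⟩⟩
    · exact C.smul_mem (inv_nonneg.2 ht.le) hwt
    · exact (linSpan F).smul_mem _ (mem_linSpan hfF)
    · rw [map_add, map_smul, hwf, smul_add, smul_smul, inv_mul_cancel₀ ht.ne']
      module
  inner_apply_le := by
    rintro w hw _ hyl _ hcm
    obtain ⟨y, hy, l, hl, rfl⟩ := Submodule.mem_sup.1 hyl
    obtain ⟨c, hc, m, hm, rfl⟩ := Submodule.mem_sup.1 hcm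
    have hwm : ⟪w y, m⟫_ℝ = ⟪y, m⟫_ℝ := by
      rw [← w.inner_map_map y m, hw.2 m hm]
    rw [map_add, hw.2 l hl, inner_add_left, inner_add_left, inner_add_right, inner_add_right y, hwm]
    linarith [h.inner_apply_le w hw.1 y hy c hc]

lemma commonFixed_fixer_linSpan (h : IsDirichlet W C) (hF : F.IsFaceOf C) :
    commonFixed (fixer W (linSpan F)) = linSpan F := by
  refine le_antisymm (fun y hy => ?_) le_commonFixed_fixer
  have hle := (h.localize hF.le).commonFixed_le
  obtain ⟨c, hc, l, hl, hcl⟩ := Submodule.mem_sup.1 (hle hy)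
  obtain ⟨d, hd, m, hm, hdm⟩ := Submodule.mem_sup.1 (hle (neg_mem hy : -y ∈ commonFixed _))
  have hcd : c + d ∈ linSpan F := by
    have : c + d = -(l + m) := by
      rw [eq_sub_of_add_eq hcl, eq_sub_of_add_eq hdm]
      abel
    exact this ▸ neg_mem (add_mem hl hm)
  have hcF : c ∈ F := hF.mem_of_add_mem_left hc hd
    (mem_of_mem_linSpan_of_isFaceOf hF (C.add_mem hc hd) hcd)
  exact hcl ▸ add_mem (mem_linSpan hcF) hl

lemma eq_inf_commonFixed_fixer (h : IsDirichlet W C) (hF : F.IsFaceOf C) :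
    F = C ⊓ (commonFixed (fixer W (linSpan F)) : PointedCone ℝ V) := by
  rw [h.commonFixed_fixer_linSpan hF]
  exact le_antisymm (fun x hx => ⟨hF.le hx, mem_linSpan hx⟩)
    fun x hx => mem_of_mem_linSpan_of_isFaceOf hF hx.1 hx.2

lemma finite_setOf_isFaceOf (h : IsDirichlet W C) :
    {F : PointedCone ℝ V | F.IsFaceOf C}.Finite := by
  refine (Set.finite_range fun G : Subgroup W =>
    C ⊓ (commonFixed (G.map W.subtype) : PointedCone ℝ V)).subset fun F hF => ?_
  refine ⟨(fixer W (linSpan F)).subgroupOf W, ?_⟩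
  change C ⊓ (commonFixed (((fixer W (linSpan F)).subgroupOf W).map W.subtype) :
    PointedCone ℝ V) = F
  rw [Subgroup.map_subgroupOf_eq_of_le fixer_le, ← h.eq_inf_commonFixed_fixer hF]

lemma isClosed_of_isFaceOf (h : IsDirichlet W C) (hF : F.IsFaceOf C) : IsClosed (F : Set V) := by
  rw [h.eq_inf_commonFixed_fixer hF]
  exact h.isClosed.inter (Submodule.closed_of_finiteDimensional _)

end Finite

end IsDirichlet

section DualCone

variable {V : Type*} [NormedAddCommGroup V] [InnerProductSpace ℝ V] [FiniteDimensional ℝ V]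
  {W : Subgroup (V ≃ₗᵢ[ℝ] V)} {C F : PointedCone ℝ V}

lemma mem_dualCone {v : V} : v ∈ dualCone C ↔ ∀ c ∈ C, 0 ≤ ⟪c, v⟫_ℝ := Iff.rfl

lemma isClosed_dualCone (C : PointedCone ℝ V) : IsClosed (dualCone C : Set V) :=
  (ProperCone.innerDual (C : Set V)).isClosed

lemma mem_dualCone_coneQuot {v : (linSpan F)ᗮ} :
    v ∈ dualCone (coneQuot C F) ↔ (v : V) ∈ dualCone C := by
  simp only [mem_dualCone, coneQuot, PointedCone.mem_map, forall_exists_index, and_imp,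
    forall_apply_eq_imp_iff₂]
  exact forall₂_congr fun c _ =>
    iff_of_eq (congrArg _ (Submodule.inner_orthogonalProjectionOnto_eq_of_mem_right v c))

lemma IsDirichlet.sub_apply_mem_dualCone (h : IsDirichlet W C) {w : V ≃ₗᵢ[ℝ] V} (hw : w ∈ W)
    {c : V} (hc : c ∈ C) : c - w c ∈ dualCone C := by
  refine mem_dualCone.2 fun d hd => ?_
  rw [inner_sub_right, sub_nonneg, real_inner_comm, real_inner_comm c]
  exact h.inner_apply_le w hw c hc d hd

omit [FiniteDimensional ℝ V] in
lemma sub_apply_mem_orthogonal_of_mem_fixer {X : Submodule ℝ V} {w : V ≃ₗᵢ[ℝ] V}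
    (hw : w ∈ fixer W X) (v : V) : v - w v ∈ Xᗮ := fun x hx => by
  rw [inner_sub_right, ← w.inner_map_map x v, hw.2 x hx, sub_self]

-- The vectors `c - w c`, for `c ∈ C` and `w` fixing `F`, lie in the dual cone of `C / F`; a vector
-- orthogonal to all of them is fixed by the stabilizer of `F`, hence lies in `⟨F⟩`.
lemma IsDirichlet.linSpan_dualCone_coneQuot [Finite W] (h : IsDirichlet W C) (hF : F.IsFaceOf C) :
    linSpan (dualCone (coneQuot C F)) = ⊤ := by
  rw [← Submodule.orthogonal_eq_bot_iff, Submodule.eq_bot_iff]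
  intro y hy
  suffices hyF : (y : V) ∈ commonFixed (fixer W (linSpan F)) from
    Subtype.ext (inner_self_eq_zero (𝕜 := ℝ).1 (y.2 y ((h.commonFixed_fixer_linSpan hF).le hyF)))
  refine mem_commonFixed.2 fun w hw => h.eq_of_forall_inner_eq fun c hc => ?_
  have hw' := inv_mem hw
  let d : (linSpan F)ᗮ := ⟨c - w⁻¹ c, sub_apply_mem_orthogonal_of_mem_fixer hw' c⟩
  have hd : ⟪c - w⁻¹ c, (y : V)⟫_ℝ = 0 := hy d
    (mem_linSpan (mem_dualCone_coneQuot.2 (h.sub_apply_mem_dualCone hw'.1 hc)))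
  rw [inner_sub_left, inner_inv_apply, sub_eq_zero] at hd
  rw [real_inner_comm, ← hd, real_inner_comm]

end DualCone

section Gaussian

lemma setOf_le_exp_neg_mul_sq_norm {E : Type*} [NormedAddCommGroup E] {b t : ℝ}
    (hb : 0 < b) (ht : 0 < t) :
    {x : E | t ≤ Real.exp (-b * ‖x‖ ^ 2)} =
      if t ≤ 1 then Metric.closedBall 0 √(-Real.log t / b) else ∅ := by
  ext x
  rw [Set.mem_ofPred_eq, ← Real.log_le_iff_le_exp ht]
  have hiff : Real.log t ≤ -b * ‖x‖ ^ 2 ↔ ‖x‖ ^ 2 ≤ -Real.log t / b := by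
    rw [le_div_iff₀ hb]
    constructor <;> intro h <;> linarith
  rw [hiff]
  split_ifs with ht1
  · rw [mem_closedBall_zero_iff, Real.le_sqrt (norm_nonneg _)
      (div_nonneg (neg_nonneg.2 (Real.log_nonpos ht.le ht1)) hb.le)]
  · have hneg : -Real.log t / b < 0 := div_neg_of_neg_of_pos
      (neg_neg_of_pos (Real.log_pos (not_le.1 ht1))) hb
    simpa using hneg.trans_le (sq_nonneg ‖x‖)

variable {E : Type*} [NormedAddCommGroup E] [InnerProductSpace ℝ E] [FiniteDimensional ℝ E]
  [MeasurableSpace E] [BorelSpace E]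

lemma stdGaussian_eq_withDensity :
    stdGaussian E = volume.withDensity fun x : E =>
      ENNReal.ofReal ((2 * π) ^ (-(finrank ℝ E : ℝ) / 2) * Real.exp (-(1 / 2) * ‖x‖ ^ 2)) := by
  set c : ℝ := (2 * π) ^ (-(finrank ℝ E : ℝ) / 2)
  have hint : Integrable fun x : E => c * Real.exp (-(1 / 2) * ‖x‖ ^ 2) := by
    refine Integrable.const_mul (Integrable.of_integral_ne_zero ?_) c
    rw [GaussianFourier.integral_rexp_neg_mul_sq_norm (by norm_num)]
    positivity
  have := isFiniteMeasure_withDensity_ofReal hint.2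
  refine Measure.ext_of_charFun (funext fun t => ?_)
  have hfourier := GaussianFourier.integral_cexp_neg_mul_sq_norm_add (V := E) (b := 1 / 2)
    (by norm_num) Complex.I t
  rw [charFun_stdGaussian, charFun_apply, integral_withDensity_eq_integral_toReal_smul
    (by fun_prop) (.of_forall fun _ => ENNReal.ofReal_lt_top)]
  have hintegrand : ∀ x : E, (ENNReal.ofReal (c * Real.exp (-(1 / 2) * ‖x‖ ^ 2))).toReal •
      Complex.exp (⟪x, t⟫_ℝ * Complex.I) =
      c * Complex.exp (-(1 / 2) * ‖x‖ ^ 2 + Complex.I * ⟪t, x⟫_ℝ) := by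
    intro x
    rw [ENNReal.toReal_ofReal (by positivity), Complex.real_smul, Complex.ofReal_mul, mul_assoc,
      Complex.ofReal_exp, ← Complex.exp_add, real_inner_comm]
    push_cast
    ring_nf
  simp_rw [hintegrand]
  have hc : (c : ℂ) * (π / (1 / 2)) ^ (finrank ℝ E / 2 : ℂ) = 1 := by
    rw [show (π / (1 / 2) : ℂ) ^ (finrank ℝ E / 2 : ℂ) =
      (((2 * π) ^ ((finrank ℝ E : ℝ) / 2) : ℝ) : ℂ) by
        rw [Complex.ofReal_cpow (by positivity)]; push_cast; ring_nf, ← Complex.ofReal_mul,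
      ← Real.rpow_add (by positivity), neg_div, neg_add_cancel, Real.rpow_zero,
      Complex.ofReal_one]
  rw [integral_const_mul, hfourier, ← mul_assoc, hc, one_mul, Complex.I_sq]
  ring_nf

lemma stdGaussian_absolutelyContinuous : stdGaussian E ≪ volume := by
  rw [stdGaussian_eq_withDensity]
  exact withDensity_absolutelyContinuous _ _

lemma volume_inter_closedBall (K : PointedCone ℝ E) {r : ℝ} (hr : 0 ≤ r) :
    volume (K ∩ Metric.closedBall 0 r : Set E) =
      ENNReal.ofReal (r ^ finrank ℝ E) * volume (K ∩ Metric.closedBall 0 1 : Set E) := by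
  have hset : (K ∩ Metric.closedBall 0 r : Set E) = r • (K ∩ Metric.closedBall 0 1 : Set E) := by
    rcases hr.eq_or_lt with rfl | hr
    · rw [Metric.closedBall_zero, Set.zero_smul_set (by exact ⟨0, K.zero_mem, by simp⟩)]
      exact Set.inter_eq_right.2 (Set.singleton_subset_iff.2 K.zero_mem)
    · have hK : r • (K : Set E) = K := by
        ext x
        rw [Set.mem_smul_set_iff_inv_smul_mem₀ hr.ne']
        exact ⟨fun h => by simpa [hr.ne'] using K.smul_mem hr.le h,
          fun h => K.smul_mem (inv_nonneg.2 hr.le) h⟩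
      rw [Set.smul_set_inter₀ hr.ne', hK, smul_unitClosedBall_of_nonneg hr.le]
  rw [hset, Measure.addHaar_smul, abs_of_nonneg (pow_nonneg hr _)]

lemma exists_setLIntegral_eq_mul_volume (b : ℝ) (hb : 0 < b) : ∃ a : ℝ≥0∞, ∀ K : PointedCone ℝ E,
    MeasurableSet (K : Set E) →
    ∫⁻ x in (K : Set E), ENNReal.ofReal (Real.exp (-b * ‖x‖ ^ 2)) =
      a * volume (K ∩ Metric.closedBall 0 1 : Set E) := by
  refine ⟨∫⁻ t in Set.Ioi (0 : ℝ), if t ≤ 1 then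
    ENNReal.ofReal (√(-Real.log t / b) ^ finrank ℝ E) else 0, fun K hK => ?_⟩
  have hfin : volume (K ∩ Metric.closedBall 0 1 : Set E) ≠ ∞ :=
    ((measure_mono Set.inter_subset_right).trans_lt measure_closedBall_lt_top).ne
  rw [lintegral_eq_lintegral_meas_le _ (.of_forall fun _ => (Real.exp_pos _).le) (by fun_prop),
    ← lintegral_mul_const' _ _ hfin]
  refine setLIntegral_congr_fun measurableSet_Ioi fun t ht => ?_
  rw [Measure.restrict_apply' hK, setOf_le_exp_neg_mul_sq_norm hb ht, Set.inter_comm]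
  split_ifs
  · exact volume_inter_closedBall K (Real.sqrt_nonneg _)
  · simp

lemma stdGaussian_mul_volume_closedBall {K : PointedCone ℝ E} (hK : MeasurableSet (K : Set E)) :
    stdGaussian E K * volume (Metric.closedBall (0 : E) 1) =
      volume (K ∩ Metric.closedBall 0 1 : Set E) := by
  obtain ⟨a, ha⟩ := exists_setLIntegral_eq_mul_volume (E := E) (1 / 2) (by norm_num)
  have hprop : ∀ L : PointedCone ℝ E, MeasurableSet (L : Set E) → stdGaussian E L =
      ENNReal.ofReal ((2 * π) ^ (-(finrank ℝ E : ℝ) / 2)) * a *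
        volume (L ∩ Metric.closedBall 0 1 : Set E) := by
    intro L hL
    rw [stdGaussian_eq_withDensity, withDensity_apply _ hL, mul_assoc, ← ha L hL,
      ← lintegral_const_mul' _ _ ENNReal.ofReal_ne_top]
    refine lintegral_congr fun x => ENNReal.ofReal_mul (by positivity)
  have htop := hprop ⊤ MeasurableSet.univ
  rw [Submodule.top_coe, measure_univ, Set.univ_inter] at htop
  rw [hprop K hK, mul_right_comm, ← htop, one_mul]

end Gaussian

section SubspaceGaussian

variable {E : Type*} [NormedAddCommGroup E] [InnerProductSpace ℝ E] [FiniteDimensional ℝ E]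

lemma starProjection_map_equiv_apply (X : Submodule ℝ E) (g : E ≃ₗᵢ[ℝ] E) (x : E) :
    (X.map (g.toLinearEquiv : E →ₗ[ℝ] E)).starProjection (g x) = g (X.starProjection x) := by
  have := Submodule.starProjection_map_apply g X (g x)
  simpa using this

variable [MeasurableSpace E] [BorelSpace E] {X Y : Submodule ℝ E}

/-- The standard Gaussian measure of the subspace `X`, regarded as a measure on the ambient space:
the law of the orthogonal projection to `X` of a standard Gaussian vector. -/
noncomputable def subspaceGaussian (X : Submodule ℝ E) : Measure E :=
  (stdGaussian E).map X.starProjection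

instance (X : Submodule ℝ E) : IsProbabilityMeasure (subspaceGaussian X) :=
  Measure.isProbabilityMeasure_map X.starProjection.continuous.aemeasurable

lemma ae_mem_subspaceGaussian : ∀ᵐ x ∂subspaceGaussian X, x ∈ X :=
  (ae_map_iff X.starProjection.continuous.aemeasurable
    (Submodule.closed_of_finiteDimensional X).measurableSet).2
    (.of_forall X.starProjection_apply_mem)

lemma subspaceGaussian_eq_zero (hXY : ¬ X ≤ Y) : subspaceGaussian X Y = 0 := by
  rw [subspaceGaussian, Measure.map_apply X.starProjection.continuous.measurable
    (Submodule.closed_of_finiteDimensional Y).measurableSet]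
  refine stdGaussian_absolutelyContinuous (Measure.addHaar_submodule volume
    (Y.comap (X.starProjection : E →ₗ[ℝ] E)) fun htop => hXY fun x hx => ?_)
  have hx' : X.starProjection x ∈ Y := htop.ge (Submodule.mem_top (x := x))
  rwa [Submodule.starProjection_eq_self_iff.2 hx] at hx'

lemma map_subspaceGaussian (X : Submodule ℝ E) (g : E ≃ₗᵢ[ℝ] E) :
    (subspaceGaussian X).map g = subspaceGaussian (X.map (g.toLinearEquiv : E →ₗ[ℝ] E)) := by
  have hcomm : g ∘ X.starProjection =
      (X.map (g.toLinearEquiv : E →ₗ[ℝ] E)).starProjection ∘ g :=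
    funext fun x => (starProjection_map_equiv_apply X g x).symm
  rw [subspaceGaussian, subspaceGaussian, Measure.map_map (by fun_prop) (by fun_prop), hcomm,
    ← Measure.map_map (by fun_prop) (by fun_prop), stdGaussian_map]

lemma subspaceGaussian_neg (X : Submodule ℝ E) {A : Set E} (hA : MeasurableSet A) :
    subspaceGaussian X (-A) = subspaceGaussian X A := by
  have hX : X.map ((LinearIsometryEquiv.neg ℝ (E := E)).toLinearEquiv : E →ₗ[ℝ] E) = X := by
    ext x
    exact ⟨fun ⟨y, hy, hxy⟩ => hxy ▸ X.neg_mem hy, fun hx => ⟨-x, X.neg_mem hx, neg_neg x⟩⟩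
  have hmap := map_subspaceGaussian X (LinearIsometryEquiv.neg ℝ)
  rw [hX] at hmap
  conv_rhs => rw [← hmap, Measure.map_apply (LinearIsometryEquiv.continuous _).measurable hA]
  rfl

lemma map_orthogonalProjectionOnto_stdGaussian (X : Submodule ℝ E) :
    (stdGaussian E).map X.orthogonalProjectionOnto = stdGaussian X := by
  refine Measure.ext_of_charFun (funext fun t => ?_)
  have hinner (x : E) : ⟪X.orthogonalProjectionOnto x, t⟫_ℝ = ⟪x, (t : E)⟫_ℝ :=
    Submodule.inner_orthogonalProjectionOnto_eq_of_mem_right t x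
  rw [charFun_apply, integral_map (by fun_prop) (by fun_prop)]
  simp_rw [hinner]
  rw [← charFun_apply, charFun_stdGaussian, charFun_stdGaussian, Submodule.coe_norm]

lemma map_subtype_stdGaussian (X : Submodule ℝ E) :
    (stdGaussian X).map Subtype.val = subspaceGaussian X := by
  rw [← map_orthogonalProjectionOnto_stdGaussian,
    Measure.map_map measurable_subtype_coe (by fun_prop)]
  rfl

lemma indepFun_starProjection_orthogonal (X : Submodule ℝ E) :
    X.starProjection ⟂ᵢ[stdGaussian E] Xᗮ.starProjection := by
  refine HasGaussianLaw.indepFun_of_covariance_inner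
    ⟨isGaussian_map (X.starProjection.prod Xᗮ.starProjection)⟩ fun x y => ?_
  simp_rw [← Submodule.inner_starProjection_left_eq_right]
  rw [← covarianceBilin_apply_eq_cov IsGaussian.memLp_two_id, covarianceBilin_stdGaussian]
  exact Submodule.inner_right_of_mem_orthogonal (X.starProjection_apply_mem x)
    (Xᗮ.starProjection_apply_mem y)

lemma stdGaussian_preimage_inter_preimage (X : Submodule ℝ E) {A B : Set E}
    (hA : MeasurableSet A) (hB : MeasurableSet B) :
    stdGaussian E (X.starProjection ⁻¹' A ∩ Xᗮ.starProjection ⁻¹' B) =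
      subspaceGaussian X A * subspaceGaussian Xᗮ B := by
  rw [(indepFun_starProjection_orthogonal X).measure_inter_preimage_eq_mul _ _ hA hB,
    subspaceGaussian, subspaceGaussian, Measure.map_apply (by fun_prop) hA,
    Measure.map_apply (by fun_prop) hB]

end SubspaceGaussian

section AngleMeasure

variable {E : Type*} [NormedAddCommGroup E] [InnerProductSpace ℝ E] [FiniteDimensional ℝ E]

lemma vol_eq_volume [m : MeasurableSpace E] [BorelSpace E] (S : Set E) :
    vol E S = volume S := by
  obtain rfl : m = borel E := BorelSpace.measurable_eq
  let : MeasurableSpace E := borel E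
  exact congrArg (fun μ : Measure E => μ S) (stdOrthonormalBasis ℝ E).addHaar_eq_volume

variable [MeasurableSpace E] [BorelSpace E]

lemma angleMeasure_eq_subspaceGaussian {K : PointedCone ℝ E} (hK : IsClosed (K : Set E)) :
    angleMeasure K = (subspaceGaussian (linSpan K)).real K := by
  let K' : PointedCone ℝ (linSpan K) :=
    K.comap (LinearMap.restrictScalars _ (linSpan K).subtype)
  have hK' : MeasurableSet (K' : Set (linSpan K)) :=
    (hK.preimage continuous_subtype_val).measurableSet
  have hball : (volume (Metric.closedBall (0 : linSpan K) 1)).toReal ≠ 0 :=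
    (ENNReal.toReal_pos (Metric.measure_closedBall_pos _ _ one_pos).ne'
      measure_closedBall_lt_top.ne).ne'
  rw [measureReal_def, ← map_subtype_stdGaussian,
    Measure.map_apply measurable_subtype_coe hK.measurableSet, angleMeasure, vol_eq_volume,
    vol_eq_volume, div_eq_iff hball, ← ENNReal.toReal_mul]
  exact congrArg _ (stdGaussian_mul_volume_closedBall hK').symm

lemma angleMeasure_dualCone_coneQuot {C F : PointedCone ℝ E}
    (hspan : linSpan (dualCone (coneQuot C F)) = ⊤) :
    angleMeasure (dualCone (coneQuot C F)) = (subspaceGaussian (linSpan F)ᗮ).real (dualCone C) := by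
  have htop : subspaceGaussian (⊤ : Submodule ℝ (linSpan F)ᗮ) = stdGaussian (linSpan F)ᗮ := by
    rw [subspaceGaussian, Submodule.starProjection_top]
    exact Measure.map_id
  rw [angleMeasure_eq_subspaceGaussian (isClosed_dualCone _), hspan, htop, measureReal_def,
    measureReal_def, ← map_subtype_stdGaussian,
    Measure.map_apply measurable_subtype_coe (isClosed_dualCone C).measurableSet]
  exact congrArg _ (congrArg _ (Set.ext fun _ => mem_dualCone_coneQuot))

end AngleMeasure

section Moreau

variable {V : Type*} [NormedAddCommGroup V] [InnerProductSpace ℝ V] [FiniteDimensional ℝ V]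
  {C F : PointedCone ℝ V} {x p q v : V}

lemma isFaceOf_inf_orthogonal (hv : v ∈ dualCone C) :
    (C ⊓ ((ℝ ∙ v)ᗮ : PointedCone ℝ V)).IsFaceOf C := by
  refine .of_mem_of_add_mem_left inf_le_left fun {x y} hx hy hxy => ⟨hx, ?_⟩
  have hsum : ⟪x + y, v⟫_ℝ = 0 := Submodule.mem_orthogonal_singleton_iff_inner_left.1 hxy.2
  rw [inner_add_left] at hsum
  refine Submodule.mem_orthogonal_singleton_iff_inner_left.2 ?_
  linarith [mem_dualCone.1 hv x hx, mem_dualCone.1 hv y hy]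

lemma exists_mem_inner_eq_zero_mem_dualCone (hC : IsClosed (C : Set V)) (x : V) :
    ∃ p ∈ C, ⟪p, p - x⟫_ℝ = 0 ∧ p - x ∈ dualCone C := by
  have hconv : Convex ℝ (C : Set V) := PointedCone.convex C
  obtain ⟨p, hp, hmin⟩ := exists_norm_eq_iInf_of_complete_convex ⟨0, C.zero_mem⟩
    hC.isComplete hconv x
  rw [norm_eq_iInf_iff_real_inner_le_zero hconv hp] at hmin
  have hadd : ∀ c ∈ C, 0 ≤ ⟪c, p - x⟫_ℝ := fun c hc => by
    have h := hmin (p + c) (C.add_mem hp hc)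
    rwa [add_sub_cancel_left, ← neg_sub, inner_neg_left, neg_nonpos, real_inner_comm] at h
  have hzero := hmin 0 C.zero_mem
  rw [zero_sub, inner_neg_right, ← inner_neg_left, neg_sub, real_inner_comm] at hzero
  exact ⟨p, hp, hzero.antisymm (hadd p hp), hadd⟩

lemma eq_of_inner_eq_zero_of_mem_dualCone (hp : p ∈ C) (hpx : ⟪p, p - x⟫_ℝ = 0)
    (hpC : p - x ∈ dualCone C) (hq : q ∈ C) (hqx : ⟪q, q - x⟫_ℝ = 0) (hqC : q - x ∈ dualCone C) :
    p = q := by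
  have hpq := mem_dualCone.1 hqC p hp
  have hqp := mem_dualCone.1 hpC q hq
  have hle : ⟪p - q, p - q⟫_ℝ ≤ 0 := by
    simp only [inner_sub_left, inner_sub_right] at hpx hqx hpq hqp ⊢
    linarith
  exact sub_eq_zero.1 ((inner_self_eq_zero (𝕜 := ℝ)).1 (hle.antisymm real_inner_self_nonneg))

/-- The vectors whose orthogonal projection to `⟨F⟩` lies in the face `F` of `C` and whose
projection to `⟨F⟩ᗮ` lies in the polar cone `-C*`; up to null sets, the vectors whose nearest point
in `C` lies in the relative interior of `F`. -/
def tile (C F : PointedCone ℝ V) : Set V :=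
  (linSpan F).starProjection ⁻¹' F ∩ (linSpan F)ᗮ.starProjection ⁻¹' (-(dualCone C : Set V))

lemma mem_tile : x ∈ tile C F ↔ (linSpan F).starProjection x ∈ F ∧
    (linSpan F).starProjection x - x ∈ dualCone C := by
  rw [tile, Set.mem_inter_iff, Set.mem_preimage, Set.mem_preimage,
    Submodule.starProjection_orthogonal_val, Set.mem_neg, neg_sub]
  rfl

lemma exists_isFaceOf_mem_tile (hC : IsClosed (C : Set V)) (x : V) :
    ∃ F : PointedCone ℝ V, F.IsFaceOf C ∧ x ∈ tile C F := by
  obtain ⟨p, hp, hpx, hpC⟩ := exists_mem_inner_eq_zero_mem_dualCone hC x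
  let F : PointedCone ℝ V := C ⊓ ((ℝ ∙ (p - x))ᗮ : PointedCone ℝ V)
  have hpF : p ∈ F := ⟨hp, Submodule.mem_orthogonal_singleton_iff_inner_left.2 hpx⟩
  have hspan : linSpan F ≤ (ℝ ∙ (p - x))ᗮ := Submodule.span_le.2 fun y hy => hy.2
  have horth : x - p ∈ (linSpan F)ᗮ := by
    rw [← neg_sub]
    exact neg_mem (Submodule.le_orthogonal_iff_le_orthogonal.1 hspan
      (Submodule.mem_span_singleton_self _))
  have hproj : (linSpan F).starProjection x = p :=
    Submodule.eq_starProjection_of_mem_orthogonal (mem_linSpan hpF) horth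
  exact ⟨F, isFaceOf_inf_orthogonal hpC, mem_tile.2 (hproj.symm ▸ ⟨hpF, hpC⟩)⟩

lemma starProjection_eq_of_mem_tile {F' : PointedCone ℝ V} (hF : F ≤ C) (hF' : F' ≤ C)
    (hx : x ∈ tile C F) (hx' : x ∈ tile C F') :
    (linSpan F).starProjection x = (linSpan F').starProjection x := by
  have hinner (G : PointedCone ℝ V) :
      ⟪(linSpan G).starProjection x, (linSpan G).starProjection x - x⟫_ℝ = 0 := by
    rw [← neg_sub, inner_neg_right, neg_eq_zero]
    exact Submodule.inner_right_of_mem_orthogonal ((linSpan G).starProjection_apply_mem x)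
      ((linSpan G).sub_starProjection_mem_orthogonal x)
  rw [mem_tile] at hx hx'
  exact eq_of_inner_eq_zero_of_mem_dualCone (hF hx.1) (hinner F) hx.2 (hF' hx'.1) (hinner F') hx'.2

variable [MeasurableSpace V] [BorelSpace V]

lemma measurableSet_tile (hF : IsClosed (F : Set V)) : MeasurableSet (tile C F) :=
  ((linSpan F).starProjection.measurable hF.measurableSet).inter
    ((linSpan F)ᗮ.starProjection.measurable (isClosed_dualCone C).measurableSet.neg)

lemma stdGaussian_tile (hF : IsClosed (F : Set V)) :
    (stdGaussian V).real (tile C F) =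
      (subspaceGaussian (linSpan F)).real F *
        (subspaceGaussian (linSpan F)ᗮ).real (dualCone C) := by
  have hC := (isClosed_dualCone C).measurableSet
  rw [measureReal_def, tile, stdGaussian_preimage_inter_preimage _ hF.measurableSet hC.neg,
    subspaceGaussian_neg _ hC, ENNReal.toReal_mul]
  rfl

end Moreau

section Generic

variable {V : Type*} [NormedAddCommGroup V] [InnerProductSpace ℝ V]
  {W : Subgroup (V ≃ₗᵢ[ℝ] V)} {X : Submodule ℝ V} {w : V ≃ₗᵢ[ℝ] V} {x : V}

lemma mem_fixer_span_singleton : w ∈ fixer W (ℝ ∙ x) ↔ w ∈ W ∧ w x = x := by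
  rw [mem_fixer_iff_le_fixedSpace, Submodule.span_singleton_le_iff_mem, mem_fixedSpace]

lemma ae_subspaceGaussian_fixer_eq [FiniteDimensional ℝ V] [MeasurableSpace V] [BorelSpace V]
    (W : Subgroup (V ≃ₗᵢ[ℝ] V)) [Finite W] (X : Submodule ℝ V) :
    ∀ᵐ x ∂subspaceGaussian X, fixer W (ℝ ∙ x) = fixer W X := by
  have hgen : ∀ᵐ x ∂subspaceGaussian X, ∀ w : W, x ∈ fixedSpace w.1 → X ≤ fixedSpace w.1 := by
    refine ae_all_iff.2 fun w => ?_
    by_cases hw : X ≤ fixedSpace w.1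
    · exact .of_forall fun _ _ => hw
    · filter_upwards [measure_eq_zero_iff_ae_notMem.1 (subspaceGaussian_eq_zero hw)] with x hx hwx
      exact absurd hwx hx
  filter_upwards [ae_mem_subspaceGaussian, hgen] with x hxX hx
  ext w
  rw [mem_fixer_span_singleton, mem_fixer_iff_le_fixedSpace]
  exact and_congr_right fun hw =>
    ⟨fun hwx => hx ⟨w, hw⟩ (mem_fixedSpace.2 hwx), fun hXw => mem_fixedSpace.1 (hXw hxX)⟩

end Generic

namespace IsDirichlet

variable {V : Type*} [NormedAddCommGroup V] [InnerProductSpace ℝ V] [FiniteDimensional ℝ V]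
  {W : Subgroup (V ≃ₗᵢ[ℝ] V)} [Finite W] {C F F' : PointedCone ℝ V}

/-- The finite set of all faces of `C`. -/
noncomputable def faceFinset (h : IsDirichlet W C) : Finset (PointedCone ℝ V) :=
  h.finite_setOf_isFaceOf.toFinset

lemma mem_faceFinset (h : IsDirichlet W C) : F ∈ h.faceFinset ↔ F.IsFaceOf C :=
  h.finite_setOf_isFaceOf.mem_toFinset

lemma eq_of_fixer_eq (h : IsDirichlet W C) (hF : F.IsFaceOf C) (hF' : F'.IsFaceOf C)
    (hfix : fixer W (linSpan F) = fixer W (linSpan F')) : F = F' := by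
  rw [h.eq_inf_commonFixed_fixer hF, h.eq_inf_commonFixed_fixer hF', hfix]

variable [MeasurableSpace V] [BorelSpace V]

-- The common projection of a point of both tiles to `⟨F⟩` and `⟨F'⟩` almost surely has the same
-- stabilizer as `F` and as `F'`, and faces are determined by their stabilizers.
lemma aedisjoint_tile (h : IsDirichlet W C) (hF : F.IsFaceOf C) (hF' : F'.IsFaceOf C)
    (hne : F ≠ F') : AEDisjoint (stdGaussian V) (tile C F) (tile C F') := by
  refine measure_eq_zero_iff_ae_notMem.2 ?_
  filter_upwards [
    ae_of_ae_map (by fun_prop) (ae_subspaceGaussian_fixer_eq W (linSpan F)),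
    ae_of_ae_map (by fun_prop) (ae_subspaceGaussian_fixer_eq W (linSpan F'))] with x hx hx' hmem
  rw [starProjection_eq_of_mem_tile hF.le hF'.le hmem.1 hmem.2] at hx
  exact hne (h.eq_of_fixer_eq hF hF' (hx.symm.trans hx'))

lemma sum_subspaceGaussian_mul_dualCone (h : IsDirichlet W C) :
    ∑ F ∈ h.faceFinset, (subspaceGaussian (linSpan F)).real F *
      (subspaceGaussian (linSpan F)ᗮ).real (dualCone C) = 1 := by
  have hclosed : ∀ F ∈ h.faceFinset, IsClosed (F : Set V) := fun F hF =>
    h.isClosed_of_isFaceOf (h.mem_faceFinset.1 hF)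
  have hcover : ⋃ F ∈ h.faceFinset, tile C F = Set.univ := by
    refine Set.eq_univ_of_forall fun x => ?_
    obtain ⟨F, hF, hx⟩ := exists_isFaceOf_mem_tile h.isClosed x
    exact Set.mem_iUnion₂.2 ⟨F, h.mem_faceFinset.2 hF, hx⟩
  have hdisj : (h.faceFinset : Set (PointedCone ℝ V)).Pairwise
      (Function.onFun (AEDisjoint (stdGaussian V)) (tile C)) := fun F hF F' hF' hne =>
    h.aedisjoint_tile (h.mem_faceFinset.1 hF) (h.mem_faceFinset.1 hF') hne
  calc ∑ F ∈ h.faceFinset, (subspaceGaussian (linSpan F)).real F *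
        (subspaceGaussian (linSpan F)ᗮ).real (dualCone C)
      = ∑ F ∈ h.faceFinset, (stdGaussian V).real (tile C F) :=
        Finset.sum_congr rfl fun F hF => (stdGaussian_tile (hclosed F hF)).symm
    _ = (stdGaussian V).real (⋃ F ∈ h.faceFinset, tile C F) :=
        (measureReal_biUnion_finset₀ hdisj fun F hF =>
          (measurableSet_tile (hclosed F hF)).nullMeasurableSet).symm
    _ = 1 := by rw [hcover, probReal_univ]

end IsDirichlet

section Elliptic

variable {V : Type*} [NormedAddCommGroup V] [InnerProductSpace ℝ V]
  {W : Subgroup (V ≃ₗᵢ[ℝ] V)} {X : Submodule ℝ V} {g : V ≃ₗᵢ[ℝ] V}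

lemma fixedSpace_conj (g w : V ≃ₗᵢ[ℝ] V) :
    fixedSpace (g * w * g⁻¹) = (fixedSpace w).map (g.toLinearEquiv : V →ₗ[ℝ] V) := by
  ext x
  rw [Submodule.mem_map_equiv, mem_fixedSpace, mem_fixedSpace]
  exact (g.toEquiv.eq_symm_apply (x := x) (y := w (g.symm x))).symm

lemma card_fixer_map (hg : g ∈ W) (X : Submodule ℝ V) :
    Nat.card (fixer W (X.map (g.toLinearEquiv : V →ₗ[ℝ] V))) = Nat.card (fixer W X) := by
  have hmap : fixer W (X.map (g.toLinearEquiv : V →ₗ[ℝ] V)) =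
      (fixer W X).map (MulAut.conj g).toMonoidHom := by
    ext w
    rw [Subgroup.mem_map_equiv, MulAut.conj_symm_apply, mem_fixer, mem_fixer,
      Subgroup.mul_mem_cancel_right _ hg, Subgroup.mul_mem_cancel_left _ (W.inv_mem hg)]
    exact and_congr_right fun _ => Set.forall_mem_image.trans
      (forall₂_congr fun x _ => (g.symm_apply_eq (x := w (g x)) (y := x)).symm)
  rw [hmap]
  exact (Nat.card_congr ((fixer W X).equivMapOfInjective _ (MulAut.conj g).injective).toEquiv).symm

/-- The proportion of elliptic elements in `W`, i.e. of elements fixing only the vectors fixed by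
the whole group. -/
noncomputable def ellipticRatio (W : Subgroup (V ≃ₗᵢ[ℝ] V)) : ℝ :=
  {w | w ∈ W ∧ fixedSpace w = commonFixed W}.ncard / Nat.card W

lemma ellipticRatio_fixer (hX : commonFixed (fixer W X) = X) :
    ellipticRatio (fixer W X) =
      ({w | w ∈ W ∧ fixedSpace w = X}.ncard : ℝ) / Nat.card (fixer W X) := by
  rw [ellipticRatio, hX]
  congr 3
  ext w
  exact and_congr_left fun hw => ⟨fun h => h.1, fun h => mem_fixer_iff_le_fixedSpace.2 ⟨h, hw.ge⟩⟩

lemma ncard_setOf_mem_and [Fintype W] (p : (V ≃ₗᵢ[ℝ] V) → Prop) [DecidablePred p] :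
    {w | w ∈ W ∧ p w}.ncard = (Finset.univ.filter fun w : W => p w).card := by
  rw [← Set.ncard_coe_finset, ← Set.ncard_image_of_injective _ W.subtype_injective]
  congr 1
  ext w
  simp [and_comm]

lemma fixer_commonFixed : fixer W (commonFixed W) = W :=
  le_antisymm fixer_le fun w hw => ⟨hw, fun _ hx => mem_commonFixed.1 hx w hw⟩

end Elliptic

lemma subspaceGaussian_real_of_isFaceOf {V : Type*} [NormedAddCommGroup V] [InnerProductSpace ℝ V]
    [FiniteDimensional ℝ V] [MeasurableSpace V] [BorelSpace V] {C F : PointedCone ℝ V}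
    (hF : F.IsFaceOf C) :
    (subspaceGaussian (linSpan F)).real F = (subspaceGaussian (linSpan F)).real C := by
  refine measureReal_congr ?_
  filter_upwards [ae_mem_subspaceGaussian] with x hx
  exact propext ⟨fun h => hF.le h, fun h => mem_of_mem_linSpan_of_isFaceOf hF h hx⟩

namespace IsDirichlet

section Averaging

variable {V : Type*} [NormedAddCommGroup V] [InnerProductSpace ℝ V] {W : Subgroup (V ≃ₗᵢ[ℝ] V)}
  {C : PointedCone ℝ V}

lemma ncard_setOf_apply_mem (h : IsDirichlet W C) (x : V) :
    {g : W | g.1 x ∈ C}.ncard = Nat.card (fixer W (ℝ ∙ x)) := by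
  obtain ⟨g₀, hg₀, hg₀x⟩ := h.exists_apply_mem x
  have hset : {g : W | g.1 x ∈ C} =
      Set.range fun w : fixer W (ℝ ∙ x) => (⟨g₀, hg₀⟩ * ⟨w, w.2.1⟩ : W) := by
    ext ⟨g, hg⟩
    refine ⟨fun hgx => ?_, ?_⟩
    · have hfix : (g₀ * g⁻¹) (g x) = g x := by
        refine h.apply_eq_of_apply_mem (W.mul_mem hg₀ (W.inv_mem hg)) hgx ?_
        change g₀ (g.symm (g x)) ∈ C
        rwa [g.symm_apply_apply]
      have hgx : g x = g₀ x := by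
        rw [← hfix]
        exact congrArg g₀ (g.symm_apply_apply x)
      refine ⟨⟨g₀⁻¹ * g, mem_fixer_span_singleton.2 ⟨W.mul_mem (W.inv_mem hg₀) hg, ?_⟩⟩,
        Subtype.ext (mul_inv_cancel_left g₀ g)⟩
      exact g₀.symm_apply_eq.2 hgx
    · rintro ⟨w, hw⟩
      obtain rfl : g₀ * w = g := congrArg Subtype.val hw
      change g₀ (w.1 x) ∈ C
      rwa [(mem_fixer_span_singleton.1 w.2).2]
  rw [hset, ← Set.image_univ, Set.ncard_image_of_injective, Set.ncard_univ]
  exact fun v w hvw => Subtype.ext (mul_left_cancel (congrArg Subtype.val hvw))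

variable [FiniteDimensional ℝ V] [MeasurableSpace V] [BorelSpace V]

lemma sum_subspaceGaussian_preimage [Fintype W] (h : IsDirichlet W C) (X : Submodule ℝ V) :
    ∑ g : W, (subspaceGaussian X).real (g.1 ⁻¹' C) = Nat.card (fixer W X) := by
  classical
  have hmeas (g : W) : MeasurableSet (g.1 ⁻¹' (C : Set V)) :=
    g.1.continuous.measurable h.isClosed.measurableSet
  calc ∑ g : W, (subspaceGaussian X).real (g.1 ⁻¹' C)
      = ∑ g : W, ∫ x, (g.1 ⁻¹' (C : Set V)).indicator 1 x ∂subspaceGaussian X :=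
        Finset.sum_congr rfl fun g _ => (integral_indicator_one (hmeas g)).symm
    _ = ∫ x, ∑ g : W, (g.1 ⁻¹' (C : Set V)).indicator 1 x ∂subspaceGaussian X :=
        (integral_finsetSum _ fun g _ => (integrable_const 1).indicator (hmeas g)).symm
    _ = ∫ x, ({g : W | g.1 x ∈ C}.ncard : ℝ) ∂subspaceGaussian X := by
        refine integral_congr_ae (.of_forall fun x => ?_)
        simp [Set.indicator_apply, Set.ncard_eq_toFinset_card']
    _ = ∫ _, (Nat.card (fixer W X) : ℝ) ∂subspaceGaussian X := by
        refine integral_congr_ae ?_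
        filter_upwards [ae_subspaceGaussian_fixer_eq W X] with x hx
        rw [h.ncard_setOf_apply_mem x, hx]
    _ = Nat.card (fixer W X) := by simp

lemma sum_fixedSpace_eq_card_mul [Fintype W] (h : IsDirichlet W C) {φ : Submodule ℝ V → ℝ}
    (hφ : ∀ g ∈ W, ∀ X, φ (X.map (g.toLinearEquiv : V →ₗ[ℝ] V)) = φ X) :
    ∑ w : W, φ (fixedSpace w.1) = Nat.card W * ∑ w : W, φ (fixedSpace w.1) /
      Nat.card (fixer W (fixedSpace w.1)) * (subspaceGaussian (fixedSpace w.1)).real C := by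
  let ψ (X : Submodule ℝ V) : ℝ := φ X / Nat.card (fixer W X)
  have hψ (X) : φ X = ∑ g : W, ψ X * (subspaceGaussian X).real (g.1 ⁻¹' C) := by
    rw [← Finset.mul_sum, h.sum_subspaceGaussian_preimage,
      div_mul_cancel₀ _ (Nat.cast_ne_zero.2 Nat.card_pos.ne')]
  have hconj (g w : W) :
      ψ (fixedSpace w.1) * (subspaceGaussian (fixedSpace w.1)).real (g.1 ⁻¹' C) =
        ψ (fixedSpace (MulAut.conj g w).1) *
          (subspaceGaussian (fixedSpace (MulAut.conj g w).1)).real C := by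
    have hX : fixedSpace (MulAut.conj g w).1 =
      (fixedSpace w.1).map (g.1.toLinearEquiv : V →ₗ[ℝ] V) := fixedSpace_conj g.1 w.1
    simp only [ψ, hX, hφ g.1 g.2, card_fixer_map g.2]
    rw [← map_subspaceGaussian, map_measureReal_apply g.1.continuous.measurable
      h.isClosed.measurableSet]
  calc ∑ w : W, φ (fixedSpace w.1)
      = ∑ g : W, ∑ w : W,
          ψ (fixedSpace w.1) * (subspaceGaussian (fixedSpace w.1)).real (g.1 ⁻¹' C) := by
        rw [Finset.sum_comm]
        exact Finset.sum_congr rfl fun w _ => hψ _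
    _ = ∑ _ : W, ∑ w : W, ψ (fixedSpace w.1) * (subspaceGaussian (fixedSpace w.1)).real C := by
        refine Finset.sum_congr rfl fun g _ => ?_
        simp only [hconj g]
        exact Equiv.sum_comp (MulAut.conj g).toEquiv fun w : W =>
          ψ (fixedSpace w.1) * (subspaceGaussian (fixedSpace w.1)).real C
    _ = _ := by rw [Finset.sum_const, nsmul_eq_mul, Finset.card_univ, Nat.card_eq_fintype_card]

end Averaging

end IsDirichlet

lemma mem_dualCone_sup_linSpan {V : Type*} [NormedAddCommGroup V] [InnerProductSpace ℝ V]
    [FiniteDimensional ℝ V] {C F : PointedCone ℝ V} {x : V} (hx : x ∈ (linSpan F)ᗮ) :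
    x ∈ dualCone (C ⊔ (linSpan F : PointedCone ℝ V)) ↔ x ∈ dualCone C := by
  refine ⟨fun h => mem_dualCone.2 fun c hc => mem_dualCone.1 h c (Submodule.mem_sup_left hc),
    fun h => mem_dualCone.2 fun _ hc => ?_⟩
  obtain ⟨a, ha, f, hf, rfl⟩ := Submodule.mem_sup.1 hc
  rw [inner_add_left, Submodule.inner_right_of_mem_orthogonal hf hx, add_zero]
  exact mem_dualCone.1 h a ha

namespace IsDirichlet

variable {V : Type*} [NormedAddCommGroup V] [InnerProductSpace ℝ V] [FiniteDimensional ℝ V]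
  {W : Subgroup (V ≃ₗᵢ[ℝ] V)} {C F : PointedCone ℝ V} {w : V ≃ₗᵢ[ℝ] V}

omit [FiniteDimensional ℝ V] in
lemma linSpan_inf_commonFixed (h : IsDirichlet W C) :
    linSpan (C ⊓ (commonFixed W : PointedCone ℝ V)) = commonFixed W := by
  rw [inf_eq_right.2 h.commonFixed_le]
  exact Submodule.span_eq (commonFixed W)

section Finite

variable [Finite W]

lemma card_fixer_linSpan_lt (h : IsDirichlet W C) (hF : F.IsFaceOf C)
    (hne : F ≠ C ⊓ (commonFixed W : PointedCone ℝ V)) :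
    Nat.card (fixer W (linSpan F)) < Nat.card W := by
  refine (Subgroup.card_le_of_le fixer_le).lt_of_ne fun hcard => hne ?_
  rw [h.eq_inf_commonFixed_fixer hF, Subgroup.eq_of_le_of_card_ge fixer_le hcard.ge]

variable [MeasurableSpace V] [BorelSpace V]

lemma subspaceGaussian_commonFixed (h : IsDirichlet W C) :
    (subspaceGaussian (commonFixed W)).real C = 1 := by
  rw [measureReal_def, ENNReal.toReal_eq_one_iff,
    ← mem_ae_iff_prob_eq_one h.isClosed.measurableSet]
  filter_upwards [ae_mem_subspaceGaussian] with x hx using h.commonFixed_le hx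

lemma subspaceGaussian_orthogonal_dualCone_sup :
    (subspaceGaussian (linSpan F)ᗮ).real (dualCone (C ⊔ (linSpan F : PointedCone ℝ V))) =
      (subspaceGaussian (linSpan F)ᗮ).real (dualCone C) := by
  refine measureReal_congr ?_
  filter_upwards [ae_mem_subspaceGaussian] with x hx
  exact propext (mem_dualCone_sup_linSpan hx)

lemma sum_subspaceGaussian_linSpan_eq (h : IsDirichlet W C) (hw : w ∈ W)
    [DecidableEq (Submodule ℝ V)] :
    ∑ F ∈ h.faceFinset with linSpan F = fixedSpace w, (subspaceGaussian (linSpan F)).real F =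
      (subspaceGaussian (fixedSpace w)).real C := by
  have hterm {F : PointedCone ℝ V} (hF : F ∈ h.faceFinset) (hFw : linSpan F = fixedSpace w) :
      (subspaceGaussian (linSpan F)).real F = (subspaceGaussian (fixedSpace w)).real C := by
    rw [subspaceGaussian_real_of_isFaceOf (h.mem_faceFinset.1 hF), hFw]
  let Fw := C ⊓ (fixedSpace w : PointedCone ℝ V)
  have hle : linSpan Fw ≤ fixedSpace w := Submodule.span_le.2 fun x hx => hx.2
  have hFw : Fw ∈ h.faceFinset := h.mem_faceFinset.2 (h.isFaceOf_inf_fixedSpace hw)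
  have huniq : ∀ F ∈ h.faceFinset, linSpan F = fixedSpace w → F = Fw := fun F hF hFw => by
    have hF := h.mem_faceFinset.1 hF
    exact le_antisymm (fun x hx => ⟨hF.le hx, hFw ▸ mem_linSpan hx⟩)
      fun x hx => mem_of_mem_linSpan_of_isFaceOf hF hx.1 (hFw ▸ hx.2)
  by_cases hspan : linSpan Fw = fixedSpace w
  · rw [Finset.sum_eq_single_of_mem Fw (Finset.mem_filter.2 ⟨hFw, hspan⟩), hterm hFw hspan]
    intro F hF hne
    rw [Finset.mem_filter] at hF
    exact absurd (huniq F hF.1 hF.2) hne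
  · have hzero : (subspaceGaussian (fixedSpace w)) (C : Set V) = 0 := by
      refine measure_mono_null_ae ?_ (subspaceGaussian_eq_zero fun hge => hspan (hle.antisymm hge))
      filter_upwards [ae_mem_subspaceGaussian] with x hx hxC
      exact mem_linSpan (⟨hxC, hx⟩ : x ∈ Fw)
    rw [measureReal_def, hzero, ENNReal.toReal_zero]
    refine Finset.sum_eq_zero fun F hF => ?_
    obtain ⟨hF, hspanF⟩ := Finset.mem_filter.1 hF
    exact absurd (huniq F hF hspanF ▸ hspanF) hspan

end Finite

variable [MeasurableSpace V] [BorelSpace V]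

lemma sum_fixedSpace_eq_card_mul_sum_faceFinset [Fintype W] (h : IsDirichlet W C)
    {φ : Submodule ℝ V → ℝ}
    (hφ : ∀ g ∈ W, ∀ X, φ (X.map (g.toLinearEquiv : V →ₗ[ℝ] V)) = φ X) :
    ∑ w : W, φ (fixedSpace w.1) = Nat.card W * ∑ F ∈ h.faceFinset,
      φ (linSpan F) * (subspaceGaussian (linSpan F)).real F *
        ellipticRatio (fixer W (linSpan F)) := by
  classical
  let ψ (X : Submodule ℝ V) : ℝ := φ X / Nat.card (fixer W X)
  rw [h.sum_fixedSpace_eq_card_mul hφ]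
  congr 1
  calc ∑ w : W, ψ (fixedSpace w.1) * (subspaceGaussian (fixedSpace w.1)).real C
      = ∑ w : W, ∑ F ∈ h.faceFinset with linSpan F = fixedSpace w.1,
          ψ (linSpan F) * (subspaceGaussian (linSpan F)).real F := by
        refine Finset.sum_congr rfl fun w _ => ?_
        rw [← h.sum_subspaceGaussian_linSpan_eq w.2, Finset.mul_sum]
        exact Finset.sum_congr rfl fun F hF => by rw [(Finset.mem_filter.1 hF).2]
    _ = ∑ F ∈ h.faceFinset, ∑ w : W with linSpan F = fixedSpace w.1,
          ψ (linSpan F) * (subspaceGaussian (linSpan F)).real F :=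
        Finset.sum_comm' fun w F => by simp [and_comm]
    _ = _ := by
        refine Finset.sum_congr rfl fun F hF => ?_
        rw [Finset.sum_const, nsmul_eq_mul, ellipticRatio_fixer (h.commonFixed_fixer_linSpan
          (h.mem_faceFinset.1 hF)), ncard_setOf_mem_and fun w => fixedSpace w = linSpan F]
        simp only [ψ, eq_comm (a := linSpan F)]
        ring

lemma sum_subspaceGaussian_mul_ellipticRatio [Finite W] (h : IsDirichlet W C) :
    ∑ F ∈ h.faceFinset, (subspaceGaussian (linSpan F)).real F *
      ellipticRatio (fixer W (linSpan F)) = 1 := by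
  have := Fintype.ofFinite W
  have hsum := h.sum_fixedSpace_eq_card_mul_sum_faceFinset (φ := 1) fun _ _ _ => rfl
  simp only [Pi.one_apply, one_mul, Finset.sum_const, Finset.card_univ, nsmul_eq_mul, mul_one,
    ← Nat.card_eq_fintype_card] at hsum
  exact (mul_eq_left₀ (Nat.cast_ne_zero.2 Nat.card_pos.ne')).1 hsum.symm

-- Both the dual angles and the elliptic ratios, weighted by the angles of the faces, sum to `1`. By
-- induction the summands agree on all faces but the smallest, hence also on the smallest.
lemma subspaceGaussian_commonFixed_orthogonal_dualCone [Finite W] (h : IsDirichlet W C) :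
    (subspaceGaussian (commonFixed W)ᗮ).real (dualCone C) = ellipticRatio W := by
  induction hn : Nat.card W using Nat.strong_induction_on generalizing W C with
  | _ n ih =>
    subst hn
    let F₀ := C ⊓ (commonFixed W : PointedCone ℝ V)
    have hF₀ : F₀ ∈ h.faceFinset := h.mem_faceFinset.2 (h.isFaceOf_inf_commonFixed le_rfl)
    have hspan : linSpan F₀ = commonFixed W := h.linSpan_inf_commonFixed
    have hother : ∀ F ∈ h.faceFinset, F ≠ F₀ → (subspaceGaussian (linSpan F)ᗮ).real (dualCone C) =
        ellipticRatio (fixer W (linSpan F)) := fun F hF hne => by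
      have hF := h.mem_faceFinset.1 hF
      have hloc := ih _ (h.card_fixer_linSpan_lt hF hne) (h.localize hF.le) rfl
      rwa [h.commonFixed_fixer_linSpan hF, subspaceGaussian_orthogonal_dualCone_sup] at hloc
    have hsum := h.sum_subspaceGaussian_mul_dualCone.trans
      h.sum_subspaceGaussian_mul_ellipticRatio.symm
    rw [← Finset.add_sum_erase _ _ hF₀, ← Finset.add_sum_erase _ _ hF₀, Finset.sum_congr rfl
      fun F hF => by rw [hother F (Finset.mem_of_mem_erase hF) (Finset.ne_of_mem_erase hF)],
      add_left_inj, subspaceGaussian_real_of_isFaceOf (h.mem_faceFinset.1 hF₀), hspan,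
      h.subspaceGaussian_commonFixed, one_mul, one_mul, fixer_commonFixed] at hsum
    exact hsum

variable [Finite W]

lemma subspaceGaussian_orthogonal_dualCone (h : IsDirichlet W C) (hF : F.IsFaceOf C) :
    (subspaceGaussian (linSpan F)ᗮ).real (dualCone C) = ellipticRatio (fixer W (linSpan F)) := by
  have hloc := (h.localize hF.le).subspaceGaussian_commonFixed_orthogonal_dualCone
  rwa [h.commonFixed_fixer_linSpan hF, subspaceGaussian_orthogonal_dualCone_sup] at hloc

omit [MeasurableSpace V] [BorelSpace V] in
lemma faces_finite (h : IsDirichlet W C) (k : ℕ) : (faces C k).Finite :=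
  h.finite_setOf_isFaceOf.subset fun _ hF => hF.1

lemma angleMeasure_mul_angleMeasure (h : IsDirichlet W C) (hF : F.IsFaceOf C) :
    angleMeasure F * angleMeasure (dualCone (coneQuot C F)) =
      (subspaceGaussian (linSpan F)).real F * ellipticRatio (fixer W (linSpan F)) := by
  rw [angleMeasure_eq_subspaceGaussian (h.isClosed_of_isFaceOf hF),
    angleMeasure_dualCone_coneQuot (h.linSpan_dualCone_coneQuot hF),
    h.subspaceGaussian_orthogonal_dualCone hF]

omit [MeasurableSpace V] [BorelSpace V] in
lemma sum_angleMeasure_faces (h : IsDirichlet W C) (k : ℕ) :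
    ∑ᶠ F ∈ faces C k, angleMeasure F * angleMeasure (dualCone (coneQuot C F)) =
      (fixedDim W k).ncard / Nat.card W := by
  classical
  borelize V
  have := Fintype.ofFinite W
  let φ (X : Submodule ℝ V) : ℝ := if finrank ℝ X = k then 1 else 0
  have hφ : ∀ g ∈ W, ∀ X, φ (X.map (g.toLinearEquiv : V →ₗ[ℝ] V)) = φ X := fun g _ X => by
    simp only [φ, LinearEquiv.finrank_map_eq]
  have hcount : ((fixedDim W k).ncard : ℝ) = ∑ w : W, φ (fixedSpace w.1) := by
    rw [Finset.sum_boole, ← ncard_setOf_mem_and (W := W) fun w => finrank ℝ (fixedSpace w) = k]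
    rfl
  have hfaces : faces C k = (h.faceFinset.filter fun F => dim F = k : Set (PointedCone ℝ V)) := by
    ext F
    simp [faces, h.mem_faceFinset]
  rw [eq_div_iff (Nat.cast_ne_zero.2 Nat.card_pos.ne'), mul_comm, hcount,
    h.sum_fixedSpace_eq_card_mul_sum_faceFinset hφ, hfaces, finsum_mem_coe_finset,
    Finset.sum_filter]
  congr 1
  refine Finset.sum_congr rfl fun F hF => ?_
  rw [h.angleMeasure_mul_angleMeasure (h.mem_faceFinset.1 hF)]
  simp only [φ, ite_mul, zero_mul, one_mul]
  rfl

end IsDirichlet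

section Roots

variable {V : Type*} [NormedAddCommGroup V] [InnerProductSpace ℝ V]
  {W : Subgroup (V ≃ₗᵢ[ℝ] V)} {x₀ v x y c : V}

/-- The orthogonal reflection in the hyperplane perpendicular to `v`. -/
noncomputable def rootReflection (v : V) : V ≃ₗᵢ[ℝ] V := (ℝ ∙ v)ᗮ.reflection

lemma rootReflection_apply (hv : ‖v‖ = 1) (x : V) :
    rootReflection v x = x - (2 * ⟪v, x⟫_ℝ) • v := by
  rw [rootReflection, Submodule.reflection_orthogonal_apply, Submodule.reflection_singleton_apply,
    hv]
  simp only [RCLike.ofReal_real_eq_id, id_eq, one_pow, div_one]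
  module

lemma inner_rootReflection_apply (hv : ‖v‖ = 1) (x y : V) :
    ⟪rootReflection v x, y⟫_ℝ = ⟪x, y⟫_ℝ - 2 * ⟪v, x⟫_ℝ * ⟪v, y⟫_ℝ := by
  rw [rootReflection_apply hv, inner_sub_left, real_inner_smul_left]

lemma rootReflection_mul_self (v : V) : rootReflection v * rootReflection v = 1 :=
  Submodule.reflection_mul_reflection _

lemma inv_rootReflection (v : V) : (rootReflection v)⁻¹ = rootReflection v :=
  inv_eq_of_mul_eq_one_left (rootReflection_mul_self v)

lemma rootReflection_smul {r : ℝ} (hr : r ≠ 0) (v : V) :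
    rootReflection (r • v) = rootReflection v := by
  simp only [rootReflection, Submodule.span_singleton_smul_eq (IsUnit.mk0 r hr) v]

lemma rootReflection_map (g : V ≃ₗᵢ[ℝ] V) (hv : ‖v‖ = 1) :
    rootReflection (g v) = g * rootReflection v * g⁻¹ := by
  ext x
  change _ = g (rootReflection v (g⁻¹ x))
  rw [rootReflection_apply (by rwa [g.norm_map]), rootReflection_apply hv, map_sub, map_smul,
    real_inner_comm (g⁻¹ x) v, inner_inv_apply, real_inner_comm (g v) x,
    show g (g⁻¹ x) = x from g.apply_symm_apply x]

/-- The roots of `W`, i.e. the unit vectors perpendicular to the reflection hyperplanes. -/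
def roots (W : Subgroup (V ≃ₗᵢ[ℝ] V)) : Set V := {v | ‖v‖ = 1 ∧ rootReflection v ∈ W}

/-- The positive roots, i.e. those on the same side of their hyperplane as `x₀`. -/
def posRoots (W : Subgroup (V ≃ₗᵢ[ℝ] V)) (x₀ : V) : Set V := {v | v ∈ roots W ∧ 0 < ⟪v, x₀⟫_ℝ}

/-- The simple roots, encoded as the positive roots whose reflection permutes the other positive
roots. -/
def simpleRoots (W : Subgroup (V ≃ₗᵢ[ℝ] V)) (x₀ : V) : Set V :=
  {a | a ∈ posRoots W x₀ ∧ ∀ b ∈ posRoots W x₀, b ≠ a → rootReflection a b ∈ posRoots W x₀}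

/-- The reflections in the simple roots, which generate the group. -/
def simpleReflections (W : Subgroup (V ≃ₗᵢ[ℝ] V)) (x₀ : V) : Set (V ≃ₗᵢ[ℝ] V) :=
  rootReflection '' simpleRoots W x₀

/-- The closed chamber of `W` containing `x₀`. -/
def chamber (W : Subgroup (V ≃ₗᵢ[ℝ] V)) (x₀ : V) : Set V :=
  {y | ∀ v ∈ posRoots W x₀, 0 ≤ ⟪v, y⟫_ℝ}

/-- The open chamber of `W` containing `x₀`. -/
def openChamber (W : Subgroup (V ≃ₗᵢ[ℝ] V)) (x₀ : V) : Set V :=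
  {y | ∀ v ∈ posRoots W x₀, 0 < ⟪v, y⟫_ℝ}

lemma map_mem_roots {g : V ≃ₗᵢ[ℝ] V} (hg : g ∈ W) (hv : v ∈ roots W) : g v ∈ roots W := by
  refine ⟨by rw [g.norm_map, hv.1], ?_⟩
  rw [rootReflection_map g hv.1]
  exact W.mul_mem (W.mul_mem hg hv.2) (W.inv_mem hg)

lemma neg_mem_roots (hv : v ∈ roots W) : -v ∈ roots W := by
  refine ⟨by rw [norm_neg, hv.1], ?_⟩
  rw [← neg_one_smul ℝ v, rootReflection_smul (by norm_num)]
  exact hv.2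

lemma ne_zero_of_mem_roots (hv : v ∈ roots W) : v ≠ 0 :=
  norm_ne_zero_iff.1 (hv.1.trans_ne one_ne_zero)

lemma finite_posRoots [Finite W] (x₀ : V) : (posRoots W x₀).Finite := by
  refine (Set.finite_range fun s : W => ‖x₀ - s.1 x₀‖⁻¹ • (x₀ - s.1 x₀)).subset fun v hv => ?_
  have hsub : x₀ - rootReflection v x₀ = (2 * ⟪v, x₀⟫_ℝ) • v := by
    rw [rootReflection_apply hv.1.1, sub_sub_cancel]
  have hpos : 0 < 2 * ⟪v, x₀⟫_ℝ := mul_pos two_pos hv.2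
  refine ⟨⟨rootReflection v, hv.1.2⟩, ?_⟩
  simp only [hsub]
  rw [norm_smul, hv.1.1, mul_one, Real.norm_of_nonneg hpos.le, inv_smul_smul₀ hpos.ne']

section Words

variable {l : List (V ≃ₗᵢ[ℝ] V)}

lemma exists_list_length_lt_of_prod_notMem_posRoots {a : V} (ha : a ∈ simpleRoots W x₀)
    (hl : ∀ s ∈ l, s ∈ simpleReflections W x₀) (hneg : l.prod a ∉ posRoots W x₀) :
    ∃ l' : List (V ≃ₗᵢ[ℝ] V), (∀ s ∈ l', s ∈ simpleReflections W x₀) ∧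
      l'.length < l.length ∧ l'.prod = l.prod * rootReflection a := by
  induction l with
  | nil => exact absurd ha.1 hneg
  | cons s t ih =>
    obtain ⟨hs, ht⟩ := List.forall_mem_cons.1 hl
    by_cases hpos : t.prod a ∈ posRoots W x₀
    · obtain ⟨b, hb, rfl⟩ := hs
      have hab : t.prod a = b := by
        by_contra hne
        rw [List.prod_cons] at hneg
        exact hneg (hb.2 _ hpos hne)
      refine ⟨t, ht, Nat.lt_succ_self _, ?_⟩
      rw [List.prod_cons, ← hab, rootReflection_map _ ha.1.1.1]
      simp only [mul_assoc, inv_mul_cancel_left, rootReflection_mul_self, mul_one]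
    · obtain ⟨t', ht', hlen, hprod⟩ := ih ht hpos
      refine ⟨s :: t', List.forall_mem_cons.2 ⟨hs, ht'⟩, Nat.succ_lt_succ hlen, ?_⟩
      rw [List.prod_cons, List.prod_cons, hprod, mul_assoc]

lemma inner_list_prod_apply_le (hy : y ∈ chamber W x₀) (hc : c ∈ chamber W x₀)
    (hl : ∀ s ∈ l, s ∈ simpleReflections W x₀) : ⟪l.prod y, c⟫_ℝ ≤ ⟪y, c⟫_ℝ := by
  induction hn : l.length using Nat.strong_induction_on generalizing l with
  | _ n ih =>
    subst hn
    rcases List.eq_nil_or_concat' l with rfl | ⟨t, s, rfl⟩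
    · rfl
    obtain ⟨ht, hs⟩ := List.forall_mem_append.1 hl
    obtain ⟨a, ha, rfl⟩ := hs s (List.mem_singleton_self s)
    have hlen : t.length < (t ++ [rootReflection a]).length := by simp
    rw [List.prod_append, List.prod_singleton]
    by_cases hpos : t.prod a ∈ posRoots W x₀
    · calc ⟪t.prod (rootReflection a y), c⟫_ℝ
          = ⟪t.prod y, c⟫_ℝ - 2 * ⟪a, y⟫_ℝ * ⟪t.prod a, c⟫_ℝ := by
            rw [rootReflection_apply ha.1.1.1, map_sub, map_smul, inner_sub_left,
              real_inner_smul_left]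
        _ ≤ ⟪t.prod y, c⟫_ℝ :=
            sub_le_self _ (mul_nonneg (mul_nonneg two_pos.le (hy a ha.1)) (hc _ hpos))
        _ ≤ ⟪y, c⟫_ℝ := ih _ hlen ht rfl
    · obtain ⟨t', ht', hlen', hprod⟩ := exists_list_length_lt_of_prod_notMem_posRoots ha ht hpos
      exact hprod ▸ ih _ (hlen'.trans hlen) ht' rfl

end Words

lemma exists_apply_mem_chamber [Finite W] (x₀ y : V) : ∃ g ∈ W, g y ∈ chamber W x₀ := by
  obtain ⟨g, hg⟩ := Finite.exists_max fun g : W => ⟪g.1 y, x₀⟫_ℝ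
  refine ⟨g, g.2, fun v hv => ?_⟩
  have hle : ⟪rootReflection v (g.1 y), x₀⟫_ℝ ≤ ⟪g.1 y, x₀⟫_ℝ :=
    hg ((⟨rootReflection v, hv.1.2⟩ : W) * g)
  rw [inner_rootReflection_apply hv.1.1, sub_le_self_iff] at hle
  linarith [nonneg_of_mul_nonneg_left hle hv.2]

lemma convex_openChamber : Convex ℝ (openChamber W x₀) := by
  have hinter : openChamber W x₀ = ⋂ v ∈ posRoots W x₀, {y | 0 < ⟪v, y⟫_ℝ} := by
    ext y
    simp [openChamber]
  rw [hinter]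
  exact convex_iInter₂ fun v _ => convex_halfSpace_gt (innerₛₗ ℝ v).isLinear 0

lemma isClosed_chamber : IsClosed (chamber W x₀) := by
  have hinter : chamber W x₀ = ⋂ v ∈ posRoots W x₀, {y | 0 ≤ ⟪v, y⟫_ℝ} := by
    ext y
    simp [chamber]
  rw [hinter]
  exact isClosed_biInter fun v _ => isClosed_le continuous_const (by fun_prop)

lemma mem_openChamber_self : x₀ ∈ openChamber W x₀ := fun _ hv => hv.2

lemma closure_openChamber : closure (openChamber W x₀) = chamber W x₀ := by
  refine (closure_minimal (fun y hy v hv => (hy v hv).le) isClosed_chamber).antisymm fun y hy => ?_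
  have hlim : Tendsto (fun t : ℝ => y + t • x₀) (𝓝[>] 0) (𝓝 y) := by
    have hcont : Continuous fun t : ℝ => y + t • x₀ := by fun_prop
    simpa using (hcont.tendsto 0).mono_left nhdsWithin_le_nhds
  refine mem_closure_of_tendsto hlim ?_
  filter_upwards [self_mem_nhdsWithin] with t ht v hv
  rw [inner_add_right, real_inner_smul_right]
  exact add_pos_of_nonneg_of_pos (hy v hv) (mul_pos ht hv.2)

lemma exists_posRoot_isLexMin [Finite W] {d : V} (hd : d ∈ posRoots W x₀) :
    ∃ a ∈ posRoots W x₀, 0 < ⟪a, d⟫_ℝ ∧ ∀ b ∈ posRoots W x₀,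
      ⟪a, x₀⟫_ℝ * ⟪b, d⟫_ℝ ≤ ⟪b, x₀⟫_ℝ * ⟪a, d⟫_ℝ ∧
        (⟪a, x₀⟫_ℝ * ⟪b, d⟫_ℝ = ⟪b, x₀⟫_ℝ * ⟪a, d⟫_ℝ → ⟪a, x₀⟫_ℝ ≤ ⟪b, x₀⟫_ℝ) := by
  obtain ⟨a, ⟨ha, had⟩, hmin⟩ := Set.exists_min_image {a | a ∈ posRoots W x₀ ∧ 0 < ⟪a, d⟫_ℝ}
    (fun a => toLex (⟪a, x₀⟫_ℝ / ⟪a, d⟫_ℝ, ⟪a, x₀⟫_ℝ)) ((finite_posRoots x₀).subset fun _ h => h.1)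
    ⟨d, hd, real_inner_self_pos.2 (ne_zero_of_mem_roots hd.1)⟩
  refine ⟨a, ha, had, fun b hb => ?_⟩
  rcases le_or_gt ⟪b, d⟫_ℝ 0 with hbd | hbd
  · have hlt : ⟪a, x₀⟫_ℝ * ⟪b, d⟫_ℝ < ⟪b, x₀⟫_ℝ * ⟪a, d⟫_ℝ :=
      (mul_nonpos_of_nonneg_of_nonpos ha.2.le hbd).trans_lt (mul_pos hb.2 had)
    exact ⟨hlt.le, fun heq => absurd heq hlt.ne⟩
  · rcases Prod.Lex.toLex_le_toLex.1 (hmin b ⟨hb, hbd⟩) with hlt | ⟨heq, hle⟩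
    · have hlt := (div_lt_div_iff₀ had hbd).1 hlt
      exact ⟨hlt.le, fun heq => absurd heq hlt.ne⟩
    · exact ⟨((div_eq_div_iff had.ne' hbd.ne').1 heq).le, fun _ => hle⟩

end Roots

section Regular

variable {V : Type*} [NormedAddCommGroup V] [InnerProductSpace ℝ V]
  {W : Subgroup (V ≃ₗᵢ[ℝ] V)} {x₀ v d : V}

lemma inner_ne_zero_of_mem_regularPoints (hx₀ : x₀ ∈ regularPoints W) (hv : v ∈ roots W) :
    ⟪v, x₀⟫_ℝ ≠ 0 := fun h =>
  hx₀ v (ne_zero_of_mem_roots hv) hv.2 (Submodule.mem_orthogonal_singleton_iff_inner_right.2 h)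

lemma neg_mem_posRoots (hx₀ : x₀ ∈ regularPoints W) (hv : v ∈ roots W) (h : v ∉ posRoots W x₀) :
    -v ∈ posRoots W x₀ := by
  refine ⟨neg_mem_roots hv, ?_⟩
  rw [inner_neg_left, neg_pos]
  exact (not_lt.1 fun hpos => h ⟨hv, hpos⟩).lt_of_ne (inner_ne_zero_of_mem_regularPoints hx₀ hv)

lemma exists_smul_mem_posRoots (hx₀ : x₀ ∈ regularPoints W) (hv : v ≠ 0)
    (hvW : rootReflection v ∈ W) : ∃ r : ℝ, r ≠ 0 ∧ r • v ∈ posRoots W x₀ := by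
  have hr : ‖v‖⁻¹ ≠ 0 := inv_ne_zero (norm_ne_zero_iff.2 hv)
  have hroot : ‖v‖⁻¹ • v ∈ roots W := ⟨norm_smul_inv_norm hv, by rwa [rootReflection_smul hr]⟩
  by_cases hpos : ‖v‖⁻¹ • v ∈ posRoots W x₀
  · exact ⟨_, hr, hpos⟩
  · exact ⟨-‖v‖⁻¹, neg_ne_zero.2 hr, neg_smul ‖v‖⁻¹ v ▸ neg_mem_posRoots hx₀ hroot hpos⟩

-- For `a` minimizing the ratio `⟪a, x₀⟫ / ⟪a, d⟫`, and then `⟪a, x₀⟫`, a positive root `b` and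
-- `b' = -s_a b` cannot both be positive: `b + b'` is a multiple `2⟪a, b⟫ < 2` of `a`, so both would
-- attain the minimal ratio and one of them would have smaller inner product with `x₀`.
lemma exists_mem_simpleRoots_inner_pos [Finite W] (hx₀ : x₀ ∈ regularPoints W)
    (hd : d ∈ posRoots W x₀) : ∃ a ∈ simpleRoots W x₀, 0 < ⟪a, d⟫_ℝ := by
  obtain ⟨a, ha, had, hmin⟩ := exists_posRoot_isLexMin hd
  refine ⟨a, ⟨ha, fun b hb hba => ?_⟩, had⟩
  by_contra hneg
  have hb' := neg_mem_posRoots hx₀ (map_mem_roots ha.1.2 hb.1) hneg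
  have hinner (z : V) :
      ⟪b, z⟫_ℝ + ⟪-rootReflection a b, z⟫_ℝ = 2 * ⟪a, b⟫_ℝ * ⟪a, z⟫_ℝ := by
    rw [inner_neg_left, inner_rootReflection_apply ha.1.1]
    ring
  have hlt : ⟪a, b⟫_ℝ < 1 := (inner_lt_one_iff_real_of_norm_eq_one ha.1.1 hb.1.1).2 hba.symm
  obtain ⟨hle, hheight⟩ := hmin b hb
  obtain ⟨hle', hheight'⟩ := hmin _ hb'
  have hsum : ⟪a, x₀⟫_ℝ * (⟪b, d⟫_ℝ + ⟪-rootReflection a b, d⟫_ℝ) =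
      (⟪b, x₀⟫_ℝ + ⟪-rootReflection a b, x₀⟫_ℝ) * ⟪a, d⟫_ℝ := by
    rw [hinner, hinner]
    ring
  rw [mul_add, add_mul] at hsum
  have hb₀ := hheight (by linarith)
  have hb₀' := hheight' (by linarith)
  have hsum₀ : ⟪b, x₀⟫_ℝ + ⟪-rootReflection a b, x₀⟫_ℝ < 2 * ⟪a, x₀⟫_ℝ := by
    rw [hinner]
    exact mul_lt_mul_of_pos_right (by linarith) ha.2
  linarith

lemma rootReflection_mem_closure_simpleReflections [Finite W] (hx₀ : x₀ ∈ regularPoints W)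
    (hd : d ∈ posRoots W x₀) : rootReflection d ∈ Subgroup.closure (simpleReflections W x₀) := by
  set G := Subgroup.closure (simpleReflections W x₀)
  by_contra hbad
  obtain ⟨d, ⟨hd, hdG⟩, hmin⟩ := Set.exists_min_image
    {d | d ∈ posRoots W x₀ ∧ rootReflection d ∉ G} (⟪·, x₀⟫_ℝ)
    ((finite_posRoots x₀).subset fun _ h => h.1) ⟨d, hd, hbad⟩
  obtain ⟨a, ha, had⟩ := exists_mem_simpleRoots_inner_pos hx₀ hd
  have haG : rootReflection a ∈ G := Subgroup.subset_closure ⟨a, ha, rfl⟩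
  have hne : d ≠ a := fun h => hdG (h ▸ haG)
  have hlower : ⟪rootReflection a d, x₀⟫_ℝ < ⟪d, x₀⟫_ℝ := by
    rw [inner_rootReflection_apply ha.1.1.1]
    exact sub_lt_self _ (mul_pos (mul_pos two_pos had) ha.1.2)
  refine hdG ?_
  have hG : rootReflection (rootReflection a d) ∈ G := by
    by_contra h
    exact hlower.not_ge (hmin _ ⟨ha.2 d hd hne, h⟩)
  rwa [rootReflection_map _ hd.1.1, Subgroup.mul_mem_cancel_right _ (G.inv_mem haG),
    Subgroup.mul_mem_cancel_left _ haG] at hG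

lemma IsFiniteReflectionGroup.le_closure_simpleReflections (hW : IsFiniteReflectionGroup W)
    (hx₀ : x₀ ∈ regularPoints W) : W ≤ Subgroup.closure (simpleReflections W x₀) := by
  have := hW.finite
  refine hW.closure_reflections.ge.trans ((Subgroup.closure_le _).2 ?_)
  rintro s ⟨hsW, v, hv, rfl⟩
  obtain ⟨r, hr, hrv⟩ := exists_smul_mem_posRoots hx₀ hv hsW
  have hmem := rootReflection_mem_closure_simpleReflections hx₀ hrv
  rwa [rootReflection_smul hr] at hmem

lemma IsFiniteReflectionGroup.exists_list_prod_eq (hW : IsFiniteReflectionGroup W)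
    (hx₀ : x₀ ∈ regularPoints W) {w : V ≃ₗᵢ[ℝ] V} (hw : w ∈ W) :
    ∃ l : List (V ≃ₗᵢ[ℝ] V), (∀ s ∈ l, s ∈ simpleReflections W x₀) ∧ l.prod = w := by
  have hmem := hW.le_closure_simpleReflections hx₀ hw
  rw [← Subgroup.mem_toSubmonoid, Subgroup.closure_toSubmonoid] at hmem
  obtain ⟨l, hl, hprod⟩ := Submonoid.exists_list_of_mem_closure hmem
  refine ⟨l, fun s hs => (hl s hs).elim id ?_, hprod⟩
  rintro ⟨a, ha, has⟩
  exact ⟨a, ha, by rw [← inv_rootReflection, has, inv_inv]⟩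

lemma connectedComponentIn_regularPoints (hx₀ : x₀ ∈ regularPoints W) :
    connectedComponentIn (regularPoints W) x₀ = openChamber W x₀ := by
  refine Set.Subset.antisymm (fun y hy v hv => ?_) ?_
  · by_contra! hneg
    have hconn : IsPreconnected ((⟪v, ·⟫_ℝ) '' connectedComponentIn (regularPoints W) x₀) :=
      isPreconnected_connectedComponentIn.image _ (by fun_prop)
    obtain ⟨z, hz, hvz⟩ := hconn.ordConnected.out (Set.mem_image_of_mem _ hy)
      (Set.mem_image_of_mem _ (mem_connectedComponentIn hx₀)) ⟨hneg, hv.2.le⟩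
    exact inner_ne_zero_of_mem_regularPoints (connectedComponentIn_subset _ _ hz) hv.1 hvz
  · refine convex_openChamber.isPreconnected.subset_connectedComponentIn mem_openChamber_self
      fun y hy v hv hvW hyv => ?_
    obtain ⟨r, -, hrv⟩ := exists_smul_mem_posRoots hx₀ hv hvW
    have hpos := hy _ hrv
    rw [real_inner_smul_left, Submodule.mem_orthogonal_singleton_iff_inner_right.1 hyv,
      mul_zero] at hpos
    exact hpos.false

lemma IsFundamentalCone.isDirichlet {C : PointedCone ℝ V} (hC : IsFundamentalCone W C)
    (hW : IsFiniteReflectionGroup W) : IsDirichlet W C := by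
  have := hW.finite
  obtain ⟨x₀, hx₀, hCx₀⟩ := hC
  rw [connectedComponentIn_regularPoints hx₀, closure_openChamber] at hCx₀
  have hmem (y : V) : y ∈ C ↔ y ∈ chamber W x₀ := by rw [← hCx₀, SetLike.mem_coe]
  refine ⟨fun y => ?_, fun w hw y hy c hc => ?_⟩
  · simpa only [hmem] using exists_apply_mem_chamber x₀ y
  rw [hmem] at hy hc
  obtain ⟨l, hl, rfl⟩ := hW.exists_list_prod_eq hx₀ hw
  exact inner_list_prod_apply_le hy hc hl

end Regular

end ReflectionCone

/-- For a fundamental cone `C` of a finite reflection group `W` in an `n`-dimensional Euclidean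
space, the sum of `σ(F) σ((C/F)*)` over the (finitely many) `k`-dimensional faces `F` of `C` equals
`|W^k| / |W|`. -/
theorem theorem1 {V : Type*} [NormedAddCommGroup V] [InnerProductSpace ℝ V]
    [FiniteDimensional ℝ V] (n : ℕ) (hn : Module.finrank ℝ V = n)
    (W : Subgroup (V ≃ₗᵢ[ℝ] V)) (hW : ReflectionCone.IsFiniteReflectionGroup W)
    (C : PointedCone ℝ V) (hC : ReflectionCone.IsFundamentalCone W C)
    (k : ℕ) (hk : k ≤ n) :
    (ReflectionCone.faces C k).Finite ∧
      ∑ᶠ F ∈ ReflectionCone.faces C k,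
          ReflectionCone.angleMeasure F *
            ReflectionCone.angleMeasure
              (ReflectionCone.dualCone (ReflectionCone.coneQuot C F)) =
        ((ReflectionCone.fixedDim W k).ncard : ℝ) / (Nat.card W : ℝ) := by
  have := hW.finite
  have h := hC.isDirichlet hW
  exact ⟨h.faces_finite k, h.sum_angleMeasure_faces k⟩
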